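/- Let $S^n$ be the unit sphere of $\mathbb R^{n+1}$ and $D^{n+1}$ the closed unit disc. Let $\Gamma^{n+1}$ be the group of diffeomorphisms of $S^n$ modulo those that extend to a diffeomorphism of $D^{n+1}$ (since reflections extend to $D^{n+1}$, this is the same as the quotient formed with orientation preserving diffeomorphisms only); write $[\phi]$ for the class of $\phi$. For a diffeomorphism $\phi:S^l\to S^l$ and a smooth map $\beta:S^k\to SO(l+1)$ put $f_\beta(x,y)=(\beta(y)x,y)$ on $S^l\times S^k$, and let $$M(\phi,\beta)=D^{l+1}\times S^k\ \cup_{f_\beta\circ(\phi\times\mathrm{id})}\ S^l\times D^{k+1}$$ be the closed smooth $(l+k+1)$-manifold in which each boundary point $(x,y)\in S^l\times S^k$ of $D^{l+1}\times S^k$ is identified with the boundary point $f_\beta(\phi(x),y)$ of $S^l\times D^{k+1}$, with the smooth structure given by the radial collars. The pairing $\tau:\Gamma^{l+1}\times\pi_kSO(l+1)\to\Gamma^{l+k+1}$ is given by $\tau([\phi],[\beta])=M(\phi,\beta)$, so that $\tau(a,c)=0$ means: $c$ has smooth representatives, and for every representative $\phi$ of $a\in\Gamma^{l+1}$ and every smooth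 representative $\beta$ of $c\in\pi_kSO(l+1)$, the manifold $M(\phi,\beta)$ is diffeomorphic to the standard sphere $S^{l+k+1}$. **Theorem.** Let $G$ be a (finite-dimensional) Lie group acting smoothly and isometrically on $S^l$, in such a way that the action is given by a homomorphism $\Delta:G\to SO(l+1)$, and let $\phi:S^l\to S^l$ be a $G$-equivariant diffeomorphism. Then for every $k\ge 0$ and every $c\in\pi_k(G)$ one has $\tau([\phi],\Delta_*c)=0$, where $\Delta_*:\pi_k(G)\to\pi_kSO(l+1)$ is the induced map. -/

import Mathlib

open scoped Manifold ContDiff Matrix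

noncomputable section

namespace TauPairing

/-! ## Gluing two smooth manifolds along an open set -/

section Gluing

variable {A B : Type*} [TopologicalSpace A] [TopologicalSpace B]

/-- The equivalence relation on `A ⊕ B` identifying `a ∈ e.source` with `e a`. -/
def glueRel (e : OpenPartialHomeomorph A B) : A ⊕ B → A ⊕ B → Prop
  | .inl a, .inl a' => a = a'
  | .inr b, .inr b' => b = b'
  | .inl a, .inr b => a ∈ e.source ∧ e a = b
  | .inr b, .inl a => a ∈ e.source ∧ e a = b

def glueSetoid (e : OpenPartialHomeomorph A B) : Setoid (A ⊕ B) where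
  r := glueRel e
  iseqv := by
    refine ⟨?_, ?_, ?_⟩
    · rintro (a | b) <;> simp [glueRel]
    · rintro (a | b) (a' | b') h <;> simp_all [glueRel]
    · rintro (a | b) (a' | b') (a'' | b'') h h' <;> simp only [glueRel] at h h' ⊢
      · exact h.trans h'
      · subst h; exact h'
      · exact e.injOn h.1 h'.1 (h.2.trans h'.2.symm)
      · exact ⟨h.1, h.2.trans h'⟩
      · exact ⟨h'.symm ▸ h.1, h' ▸ h.2⟩
      · exact h.2.symm.trans h'.2
      · subst h; exact h'
      · exact h.trans h'

/-- The space `A ∪_e B`, with the quotient topology. -/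
def Glued (e : OpenPartialHomeomorph A B) : Type _ := Quotient (glueSetoid e)

instance (e : OpenPartialHomeomorph A B) : TopologicalSpace (Glued e) :=
  inferInstanceAs (TopologicalSpace (Quotient (glueSetoid e)))

namespace Glued

variable (e : OpenPartialHomeomorph A B)

def inl (a : A) : Glued e := Quotient.mk (glueSetoid e) (.inl a)

def inr (b : B) : Glued e := Quotient.mk (glueSetoid e) (.inr b)

variable {e}

theorem inl_eq_inl {a a' : A} : inl e a = inl e a' ↔ a = a' := Quotient.eq (r := glueSetoid e)

theorem inr_eq_inr {b b' : B} : inr e b = inr e b' ↔ b = b' := Quotient.eq (r := glueSetoid e)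

theorem inl_eq_inr {a : A} {b : B} : inl e a = inr e b ↔ a ∈ e.source ∧ e a = b :=
  Quotient.eq (r := glueSetoid e)

variable (e)

theorem exists_rep (p : Glued e) : (∃ a, inl e a = p) ∨ ∃ b, inr e b = p := by
  induction p using Quotient.inductionOn with
  | h x => rcases x with a | b
           · exact .inl ⟨a, rfl⟩
           · exact .inr ⟨b, rfl⟩

theorem isOpen_iff {s : Set (Glued e)} :
    IsOpen s ↔ IsOpen (inl e ⁻¹' s) ∧ IsOpen (inr e ⁻¹' s) :=
  (isOpen_coinduced (f := Quotient.mk (glueSetoid e))).trans isOpen_sum_iff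

theorem isOpenEmbedding_inl : Topology.IsOpenEmbedding (inl e) := by
  refine .of_continuous_injective_isOpenMap ?_ (fun a a' h => inl_eq_inl.1 h) fun U hU => ?_
  · exact continuous_def.2 fun s hs => ((isOpen_iff e).1 hs).1
  · refine (isOpen_iff e).2 ⟨?_, ?_⟩
    · convert hU using 1
      ext a
      simp [inl_eq_inl]
    · convert e.isOpen_image_source_inter hU using 1
      ext b
      simp only [Set.mem_preimage, Set.mem_image, inl_eq_inr, Set.mem_inter_iff]
      grind

theorem isOpenEmbedding_inr : Topology.IsOpenEmbedding (inr e) := by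
  refine .of_continuous_injective_isOpenMap ?_ (fun a a' h => inr_eq_inr.1 h) fun U hU => ?_
  · exact continuous_def.2 fun s hs => ((isOpen_iff e).1 hs).2
  · refine (isOpen_iff e).2 ⟨?_, ?_⟩
    · convert e.isOpen_inter_preimage hU using 1
      ext a
      simp only [Set.mem_preimage, Set.mem_image, Set.mem_inter_iff]
      constructor
      · rintro ⟨b, hb, h⟩
        obtain ⟨h1, rfl⟩ := inl_eq_inr.1 h.symm
        exact ⟨h1, hb⟩
      · rintro ⟨h1, h2⟩
        exact ⟨_, h2, (inl_eq_inr.2 ⟨h1, rfl⟩).symm⟩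
    · convert hU using 1
      ext a
      simp [inr_eq_inr]

variable [Nonempty A] [Nonempty B]

/-- A chart of `A`, regarded as a chart of `A ∪_e B`. -/
def liftl {F : Type*} [TopologicalSpace F] (χ : OpenPartialHomeomorph A F) :
    OpenPartialHomeomorph (Glued e) F :=
  ((isOpenEmbedding_inl e).toOpenPartialHomeomorph (inl e)).symm.trans χ

/-- A chart of `B`, regarded as a chart of `A ∪_e B`. -/
def liftr {F : Type*} [TopologicalSpace F] (χ : OpenPartialHomeomorph B F) :
    OpenPartialHomeomorph (Glued e) F :=
  ((isOpenEmbedding_inr e).toOpenPartialHomeomorph (inr e)).symm.trans χ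

end Glued

variable {E₁ H₁ E₂ H₂ F : Type*}
  [NormedAddCommGroup E₁] [NormedSpace ℝ E₁] [TopologicalSpace H₁]
  [NormedAddCommGroup E₂] [NormedSpace ℝ E₂] [TopologicalSpace H₂]
  [NormedAddCommGroup F] [NormedSpace ℝ F]

/-- The preferred chart of `A` at `a`, followed by a linear isomorphism of the model vector space
`E₁` with `F`. -/
def flatChart (I₁ : ModelWithCorners ℝ E₁ H₁) [I₁.Boundaryless] [ChartedSpace H₁ A]
    (L : E₁ ≃L[ℝ] F) (a : A) : OpenPartialHomeomorph A F :=
  ((chartAt H₁ a).transHomeomorph I₁.toHomeomorph).transHomeomorph L.toHomeomorph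

theorem mem_flatChart_source (I₁ : ModelWithCorners ℝ E₁ H₁) [I₁.Boundaryless] [ChartedSpace H₁ A]
    (L : E₁ ≃L[ℝ] F) (a : A) : a ∈ (flatChart I₁ L a).source := mem_chart_source H₁ a

theorem contMDiffOn_flatChart (I₁ : ModelWithCorners ℝ E₁ H₁) [I₁.Boundaryless]
    [ChartedSpace H₁ A] [IsManifold I₁ ∞ A] (L : E₁ ≃L[ℝ] F) (a : A) :
    ContMDiffOn I₁ 𝓘(ℝ, F) ∞ (flatChart I₁ L a) (flatChart I₁ L a).source := by
  have h := contMDiffOn_extChartAt (I := I₁) (n := ∞) (x := a)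
  exact L.contDiff.contMDiff.comp_contMDiffOn h

theorem contMDiffOn_flatChart_symm (I₁ : ModelWithCorners ℝ E₁ H₁) [I₁.Boundaryless]
    [ChartedSpace H₁ A] [IsManifold I₁ ∞ A] (L : E₁ ≃L[ℝ] F) (a : A) :
    ContMDiffOn 𝓘(ℝ, F) I₁ ∞ (flatChart I₁ L a).symm (flatChart I₁ L a).target := by
  have h := contMDiffOn_extChartAt_symm (I := I₁) (n := ∞) a
  refine h.comp L.symm.contDiff.contMDiff.contMDiffOn ?_
  intro y hy
  simpa [flatChart, extChartAt, I₁.range_eq_univ, ← Set.mem_range] using hy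

theorem contMDiffOn_transition {I₁ : ModelWithCorners ℝ E₁ H₁} [ChartedSpace H₁ A]
    {I₂ : ModelWithCorners ℝ E₂ H₂} [ChartedSpace H₂ B]
    {χ : OpenPartialHomeomorph A F} (hχ : ContMDiffOn 𝓘(ℝ, F) I₁ ∞ χ.symm χ.target)
    {χ' : OpenPartialHomeomorph B F} (hχ' : ContMDiffOn I₂ 𝓘(ℝ, F) ∞ χ' χ'.source)
    {g : A → B} {s : Set A} (hg : ContMDiffOn I₁ I₂ ∞ g s) {f : F → F} {t : Set F}
    (h : ∀ y ∈ t, y ∈ χ.target ∧ χ.symm y ∈ s ∧ g (χ.symm y) ∈ χ'.source ∧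
      f y = χ' (g (χ.symm y))) : ContMDiffOn 𝓘(ℝ, F) 𝓘(ℝ, F) ∞ f t :=
  (hχ'.comp (hg.comp (hχ.mono fun y hy => (h y hy).1) fun y hy => (h y hy).2.1)
    fun y hy => (h y hy).2.2.1).congr fun y hy => (h y hy).2.2.2

/-- The smooth atlas of `A ∪_e B`: all charts of `A` and all charts of `B`, where the model vector
spaces of `A` and of `B` are identified with one vector space `F`. -/
@[reducible] def Glued.chartedSpace [Nonempty A] [Nonempty B] (e : OpenPartialHomeomorph A B)
    (I₁ : ModelWithCorners ℝ E₁ H₁) [I₁.Boundaryless] [ChartedSpace H₁ A] (L₁ : E₁ ≃L[ℝ] F)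
    (I₂ : ModelWithCorners ℝ E₂ H₂) [I₂.Boundaryless] [ChartedSpace H₂ B] (L₂ : E₂ ≃L[ℝ] F) :
    ChartedSpace F (Glued e) where
  atlas := Set.range (fun a => Glued.liftl e (flatChart I₁ L₁ a)) ∪
    Set.range (fun b => Glued.liftr e (flatChart I₂ L₂ b))
  chartAt p := match p.out with
    | .inl a => Glued.liftl e (flatChart I₁ L₁ a)
    | .inr b => Glued.liftr e (flatChart I₂ L₂ b)
  mem_chart_source p := by
    have hp : Quotient.mk (glueSetoid e) p.out = p := Quotient.out_eq p
    rcases h : p.out with a | b <;> rw [h] at hp <;> simp only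
    · change Glued.inl e a = p at hp
      subst hp
      have := mem_flatChart_source I₁ L₁ a
      refine ⟨by simp, ?_⟩
      have h2 := ((Glued.isOpenEmbedding_inl e).toOpenPartialHomeomorph (Glued.inl e)).left_inv
        (x := a) (by simp)
      simp only [Topology.IsOpenEmbedding.toOpenPartialHomeomorph_apply] at h2
      exact (congrArg (· ∈ (flatChart I₁ L₁ a).source) h2).mpr this
    · change Glued.inr e b = p at hp
      subst hp
      have := mem_flatChart_source I₂ L₂ b
      refine ⟨by simp, ?_⟩
      have h2 := ((Glued.isOpenEmbedding_inr e).toOpenPartialHomeomorph (Glued.inr e)).left_inv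
        (x := b) (by simp)
      simp only [Topology.IsOpenEmbedding.toOpenPartialHomeomorph_apply] at h2
      exact (congrArg (· ∈ (flatChart I₂ L₂ b).source) h2).mpr this
  chart_mem_atlas p := by
    rcases p.out with a | b
    · exact .inl ⟨a, rfl⟩
    · exact .inr ⟨b, rfl⟩

theorem Glued.isManifold [Nonempty A] [Nonempty B] (e : OpenPartialHomeomorph A B)
    (I₁ : ModelWithCorners ℝ E₁ H₁) [I₁.Boundaryless] [ChartedSpace H₁ A] (L₁ : E₁ ≃L[ℝ] F)
    (I₂ : ModelWithCorners ℝ E₂ H₂) [I₂.Boundaryless] [ChartedSpace H₂ B] (L₂ : E₂ ≃L[ℝ] F)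
    [IsManifold I₁ ∞ A] [IsManifold I₂ ∞ B]
    (he : ContMDiffOn I₁ I₂ ∞ e e.source) (he' : ContMDiffOn I₂ I₁ ∞ e.symm e.target) :
    let _ := Glued.chartedSpace e I₁ L₁ I₂ L₂
    IsManifold 𝓘(ℝ, F) ∞ (Glued e) := by
  let _ := Glued.chartedSpace e I₁ L₁ I₂ L₂
  have keyl (a : A) : ((Glued.isOpenEmbedding_inl e).toOpenPartialHomeomorph (Glued.inl e)).symm
      (Glued.inl e a) = a := by
    simpa using ((Glued.isOpenEmbedding_inl e).toOpenPartialHomeomorph (Glued.inl e)).left_inv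
        (x := a) (by simp)
  have keyr (b : B) : ((Glued.isOpenEmbedding_inr e).toOpenPartialHomeomorph (Glued.inr e)).symm
      (Glued.inr e b) = b := by
    simpa using ((Glued.isOpenEmbedding_inr e).toOpenPartialHomeomorph (Glued.inr e)).left_inv
        (x := b) (by simp)
  refine isManifold_of_contDiffOn _ _ _ fun c c' hc hc' => ?_
  rw [← contMDiffOn_iff_contDiffOn]
  simp only [modelWithCornersSelf_coe, modelWithCornersSelf_coe_symm, Function.comp_id,
    Function.id_comp, Set.preimage_id, Set.range_id, Set.inter_univ]
  rcases hc with ⟨a, rfl⟩ | ⟨b, rfl⟩ <;> rcases hc' with ⟨a', rfl⟩ | ⟨b', rfl⟩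
  · set χ := flatChart I₁ L₁ a
    set χ' := flatChart I₁ L₁ a'
    have hr (x : A) (h : Glued.inl e x ∈ Set.range (Glued.inl e)) : x ∈ Set.univ ∧
        ((Glued.isOpenEmbedding_inl e).toOpenPartialHomeomorph (Glued.inl e)).symm
          (Glued.inl e x) = id x := by
      exact ⟨trivial, keyl x⟩
    have hsrc (y : F) (hy : y ∈ ((Glued.liftl e χ).symm.trans (Glued.liftl e χ')).source) :
        Glued.inl e (χ.symm y) ∈ Set.range (Glued.inl e) := by
      have this : Glued.inl e (χ.symm y) ∈
          ((Glued.isOpenEmbedding_inl e).toOpenPartialHomeomorph (Glued.inl e)).target := hy.2.1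
      rwa [Topology.IsOpenEmbedding.toOpenPartialHomeomorph_target] at this
    refine contMDiffOn_transition (contMDiffOn_flatChart_symm I₁ L₁ a)
      (contMDiffOn_flatChart I₁ L₁ a') (g := id) (s := Set.univ) contMDiffOn_id
      fun y hy => ⟨hy.1.1, (hr _ (hsrc y hy)).1, ?_, ?_⟩
    · have := hy.2.2
      change ((Glued.isOpenEmbedding_inl e).toOpenPartialHomeomorph (Glued.inl e)).symm
        (Glued.inl e (χ.symm y)) ∈ χ'.source at this
      rwa [(hr _ (hsrc y hy)).2] at this
    · exact congrArg χ' (hr _ (hsrc y hy)).2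
  · set χ := flatChart I₁ L₁ a
    set χ' := flatChart I₂ L₂ b'
    have hr (x : A) (h : Glued.inl e x ∈ Set.range (Glued.inr e)) : x ∈ e.source ∧
        ((Glued.isOpenEmbedding_inr e).toOpenPartialHomeomorph (Glued.inr e)).symm
          (Glued.inl e x) = e x := by
      obtain ⟨b, hb⟩ := h
      obtain ⟨h1, h2⟩ := Glued.inl_eq_inr.1 hb.symm
      exact ⟨h1, by rw [← hb, keyr, h2]⟩
    have hsrc (y : F) (hy : y ∈ ((Glued.liftl e χ).symm.trans (Glued.liftr e χ')).source) :
        Glued.inl e (χ.symm y) ∈ Set.range (Glued.inr e) := by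
      have this : Glued.inl e (χ.symm y) ∈
          ((Glued.isOpenEmbedding_inr e).toOpenPartialHomeomorph (Glued.inr e)).target := hy.2.1
      rwa [Topology.IsOpenEmbedding.toOpenPartialHomeomorph_target] at this
    refine contMDiffOn_transition (contMDiffOn_flatChart_symm I₁ L₁ a)
      (contMDiffOn_flatChart I₂ L₂ b') (g := e) (s := e.source) he
      fun y hy => ⟨hy.1.1, (hr _ (hsrc y hy)).1, ?_, ?_⟩
    · have := hy.2.2
      change ((Glued.isOpenEmbedding_inr e).toOpenPartialHomeomorph (Glued.inr e)).symm
        (Glued.inl e (χ.symm y)) ∈ χ'.source at this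
      rwa [(hr _ (hsrc y hy)).2] at this
    · exact congrArg χ' (hr _ (hsrc y hy)).2
  · set χ := flatChart I₂ L₂ b
    set χ' := flatChart I₁ L₁ a'
    have hr (x : B) (h : Glued.inr e x ∈ Set.range (Glued.inl e)) : x ∈ e.target ∧
        ((Glued.isOpenEmbedding_inl e).toOpenPartialHomeomorph (Glued.inl e)).symm
          (Glued.inr e x) = e.symm x := by
      obtain ⟨a, ha⟩ := h
      obtain ⟨h1, h2⟩ := Glued.inl_eq_inr.1 ha
      subst h2
      exact ⟨e.map_source h1, by rw [← ha, keyl, e.left_inv h1]⟩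
    have hsrc (y : F) (hy : y ∈ ((Glued.liftr e χ).symm.trans (Glued.liftl e χ')).source) :
        Glued.inr e (χ.symm y) ∈ Set.range (Glued.inl e) := by
      have this : Glued.inr e (χ.symm y) ∈
          ((Glued.isOpenEmbedding_inl e).toOpenPartialHomeomorph (Glued.inl e)).target := hy.2.1
      rwa [Topology.IsOpenEmbedding.toOpenPartialHomeomorph_target] at this
    refine contMDiffOn_transition (contMDiffOn_flatChart_symm I₂ L₂ b)
      (contMDiffOn_flatChart I₁ L₁ a') (g := e.symm) (s := e.target) he'
      fun y hy => ⟨hy.1.1, (hr _ (hsrc y hy)).1, ?_, ?_⟩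
    · have := hy.2.2
      change ((Glued.isOpenEmbedding_inl e).toOpenPartialHomeomorph (Glued.inl e)).symm
        (Glued.inr e (χ.symm y)) ∈ χ'.source at this
      rwa [(hr _ (hsrc y hy)).2] at this
    · exact congrArg χ' (hr _ (hsrc y hy)).2
  · set χ := flatChart I₂ L₂ b
    set χ' := flatChart I₂ L₂ b'
    have hr (x : B) (h : Glued.inr e x ∈ Set.range (Glued.inr e)) : x ∈ Set.univ ∧
        ((Glued.isOpenEmbedding_inr e).toOpenPartialHomeomorph (Glued.inr e)).symm
          (Glued.inr e x) = id x := by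
      exact ⟨trivial, keyr x⟩
    have hsrc (y : F) (hy : y ∈ ((Glued.liftr e χ).symm.trans (Glued.liftr e χ')).source) :
        Glued.inr e (χ.symm y) ∈ Set.range (Glued.inr e) := by
      have this : Glued.inr e (χ.symm y) ∈
          ((Glued.isOpenEmbedding_inr e).toOpenPartialHomeomorph (Glued.inr e)).target := hy.2.1
      rwa [Topology.IsOpenEmbedding.toOpenPartialHomeomorph_target] at this
    refine contMDiffOn_transition (contMDiffOn_flatChart_symm I₂ L₂ b)
      (contMDiffOn_flatChart I₂ L₂ b') (g := id) (s := Set.univ) contMDiffOn_id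
      fun y hy => ⟨hy.1.1, (hr _ (hsrc y hy)).1, ?_, ?_⟩
    · have := hy.2.2
      change ((Glued.isOpenEmbedding_inr e).toOpenPartialHomeomorph (Glued.inr e)).symm
        (Glued.inr e (χ.symm y)) ∈ χ'.source at this
      rwa [(hr _ (hsrc y hy)).2] at this
    · exact congrArg χ' (hr _ (hsrc y hy)).2

end Gluing

/-! ## Spheres and `D^{l+1} × S^k ∪_f S^l × D^{k+1}` -/

/-- The Euclidean space `ℝ^n`. -/
abbrev V (n : ℕ) : Type := EuclideanSpace ℝ (Fin n)

/-- The unit sphere `S^n` of `ℝ^{n+1}`. -/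
abbrev S (n : ℕ) : Type := Metric.sphere (0 : V (n + 1)) 1

/-- The base point of `S^n`. -/
def pole (n : ℕ) : S n := ⟨EuclideanSpace.single 0 1, by simp⟩

instance (n : ℕ) : Nonempty (S n) := ⟨pole n⟩

open Classical in
/-- The direction `v / |v|` of `v ≠ 0` (the value at `0` is irrelevant). -/
def dir {n : ℕ} (v : V (n + 1)) : S n :=
  if h : v = 0 then pole n else ⟨‖v‖⁻¹ • v, by simp [norm_smul, h]⟩

theorem coe_dir {n : ℕ} {v : V (n + 1)} (h : v ≠ 0) : (dir v : V (n + 1)) = ‖v‖⁻¹ • v := by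
  simp [dir, h]

theorem dir_smul {n : ℕ} {t : ℝ} (ht : 0 < t) (x : S n) : dir (t • (x : V (n + 1))) = x := by
  have hx : ‖(x : V (n + 1))‖ = 1 := by simp
  have h0 : t • (x : V (n + 1)) ≠ 0 := by
    rw [← norm_ne_zero_iff, norm_smul, hx]; simp [ht.ne']
  ext1
  rw [coe_dir h0, norm_smul, hx, mul_one, Real.norm_of_nonneg ht.le, smul_smul,
    inv_mul_cancel₀ ht.ne', one_smul]

theorem contMDiffOn_dir (n : ℕ) :
    ContMDiffOn 𝓘(ℝ, V (n + 1)) (𝓡 n) ∞ (dir (n := n)) {v | v ≠ 0} := by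
  let U : TopologicalSpace.Opens (V (n + 1)) := ⟨{v | v ≠ 0}, isOpen_ne⟩
  have h1 : ContMDiff 𝓘(ℝ, V (n + 1)) 𝓘(ℝ, V (n + 1)) ∞
      (fun v : U => ((dir (v : V (n + 1)) : S n) : V (n + 1))) := by
    intro v
    refine (contMDiffAt_subtype_iff (U := U)
      (f := fun v : V (n + 1) => ((dir v : S n) : V (n + 1)))).2 ?_
    have hv : (v : V (n + 1)) ≠ 0 := v.2
    have h2 : ContDiffAt ℝ ∞ (fun v : V (n + 1) => ‖v‖⁻¹ • v) v :=
      ((contDiffAt_norm ℝ hv).inv (norm_ne_zero_iff.2 hv)).smul contDiffAt_id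
    refine h2.contMDiffAt.congr_of_eventuallyEq ?_
    filter_upwards [isOpen_ne.mem_nhds hv] with w hw using coe_dir hw
  have : Fact (Module.finrank ℝ (V (n + 1)) = n + 1) := ⟨by simp⟩
  have h3 := h1.codRestrict_sphere (n := n) (fun v => (dir (v : V (n + 1))).2)
  intro v hv
  exact ((contMDiffAt_subtype_iff (U := U) (f := dir (n := n)) (x := ⟨v, hv⟩)).1
    (h3 ⟨v, hv⟩)).contMDiffWithinAt

/-- Diffeomorphisms of `S^l × S^k`. -/
abbrev SphereProdDiffeo (l k : ℕ) : Type :=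
  (S l × S k) ≃ₘ⟮(𝓡 l).prod (𝓡 k), (𝓡 l).prod (𝓡 k)⟯ (S l × S k)

section Overlap

variable {l k : ℕ} (f : SphereProdDiffeo l k)

def overlapFun (p : V (l + 1) × S k) : S l × V (k + 1) :=
  ((f (dir p.1, p.2)).1, ‖p.1‖⁻¹ • ((f (dir p.1, p.2)).2 : V (k + 1)))

def overlapInv (p : S l × V (k + 1)) : V (l + 1) × S k :=
  (‖p.2‖⁻¹ • ((f.symm (p.1, dir p.2)).1 : V (l + 1)), (f.symm (p.1, dir p.2)).2)

theorem contMDiffOn_overlapFun :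
    ContMDiffOn (𝓘(ℝ, V (l + 1)).prod (𝓡 k)) ((𝓡 l).prod 𝓘(ℝ, V (k + 1))) ∞
      (overlapFun f) {p | p.1 ≠ 0} := by
  have hd : ContMDiffOn (𝓘(ℝ, V (l + 1)).prod (𝓡 k)) ((𝓡 l).prod (𝓡 k)) ∞
      (fun p : V (l + 1) × S k => f (dir p.1, p.2)) {p | p.1 ≠ 0} :=
    f.contMDiff.comp_contMDiffOn
      (((contMDiffOn_dir l).comp contMDiffOn_fst fun p hp => hp).prodMk contMDiffOn_snd)
  have hn : ContMDiffOn (𝓘(ℝ, V (l + 1)).prod (𝓡 k)) 𝓘(ℝ, ℝ) ∞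
      (fun p : V (l + 1) × S k => ‖p.1‖⁻¹) {p | p.1 ≠ 0} := by
    have h : ContDiffOn ℝ ∞ (fun v : V (l + 1) => ‖v‖⁻¹) {v | v ≠ 0} := fun v hv =>
      ((contDiffAt_norm ℝ hv).inv (norm_ne_zero_iff.2 hv)).contDiffWithinAt
    exact h.contMDiffOn.comp contMDiffOn_fst fun p hp => hp
  have : Fact (Module.finrank ℝ (V (k + 1)) = k + 1) := ⟨by simp⟩
  exact (contMDiff_fst.comp_contMDiffOn hd).prodMk
    (hn.smul (contMDiff_coe_sphere.comp_contMDiffOn (contMDiff_snd.comp_contMDiffOn hd)))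

theorem contMDiffOn_overlapInv :
    ContMDiffOn ((𝓡 l).prod 𝓘(ℝ, V (k + 1))) (𝓘(ℝ, V (l + 1)).prod (𝓡 k)) ∞
      (overlapInv f) {p | p.2 ≠ 0} := by
  have hd : ContMDiffOn ((𝓡 l).prod 𝓘(ℝ, V (k + 1))) ((𝓡 l).prod (𝓡 k)) ∞
      (fun p : S l × V (k + 1) => f.symm (p.1, dir p.2)) {p | p.2 ≠ 0} :=
    f.symm.contMDiff.comp_contMDiffOn
      (contMDiffOn_fst.prodMk ((contMDiffOn_dir k).comp contMDiffOn_snd fun p hp => hp))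
  have hn : ContMDiffOn ((𝓡 l).prod 𝓘(ℝ, V (k + 1))) 𝓘(ℝ, ℝ) ∞
      (fun p : S l × V (k + 1) => ‖p.2‖⁻¹) {p | p.2 ≠ 0} := by
    have h : ContDiffOn ℝ ∞ (fun v : V (k + 1) => ‖v‖⁻¹) {v | v ≠ 0} := fun v hv =>
      ((contDiffAt_norm ℝ hv).inv (norm_ne_zero_iff.2 hv)).contDiffWithinAt
    exact h.contMDiffOn.comp contMDiffOn_snd fun p hp => hp
  have : Fact (Module.finrank ℝ (V (l + 1)) = l + 1) := ⟨by simp⟩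
  exact (hn.smul (contMDiff_coe_sphere.comp_contMDiffOn
    (contMDiff_fst.comp_contMDiffOn hd))).prodMk (contMDiff_snd.comp_contMDiffOn hd)

/-- The identification `(t x, y) ↔ (x', t⁻¹ y')`, for `(x', y') = f (x, y)` and `t > 0`, between
`(ℝ^{l+1} ∖ 0) × S^k` and `S^l × (ℝ^{k+1} ∖ 0)`. -/
def overlap : OpenPartialHomeomorph (V (l + 1) × S k) (S l × V (k + 1)) where
  toFun := overlapFun f
  invFun := overlapInv f
  source := {p | p.1 ≠ 0}
  target := {p | p.2 ≠ 0}
  map_source' p hp := by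
    refine norm_ne_zero_iff.1 ?_
    simpa [overlapFun, norm_smul] using hp
  map_target' p hp := by
    refine norm_ne_zero_iff.1 ?_
    simpa [overlapInv, norm_smul] using hp
  left_inv' p hp := by
    have h : ‖p.1‖ ≠ 0 := norm_ne_zero_iff.2 hp
    have h' : 0 < ‖p.1‖⁻¹ := by positivity
    have hp' : p.1 ≠ 0 := hp
    simp only [overlapFun, overlapInv, dir_smul h']
    simp [norm_smul, coe_dir hp', smul_smul, h]
  right_inv' p hp := by
    have h : ‖p.2‖ ≠ 0 := norm_ne_zero_iff.2 hp
    have h' : 0 < ‖p.2‖⁻¹ := by positivity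
    have hp' : p.2 ≠ 0 := hp
    simp only [overlapFun, overlapInv, dir_smul h']
    simp [norm_smul, coe_dir hp', smul_smul, h]
  open_source := isOpen_ne.preimage continuous_fst
  open_target := isOpen_ne.preimage continuous_snd
  continuousOn_toFun := (contMDiffOn_overlapFun f).continuousOn
  continuousOn_invFun := (contMDiffOn_overlapInv f).continuousOn

/-- The closed manifold `D^{l+1} × S^k ∪_f S^l × D^{k+1}`, in which the boundary point `(x, y)` of
the first piece is identified with the boundary point `f (x, y)` of the second one. The smooth
structure is the one given by the radial collars of the two boundaries: the pieces are enlarged to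
the open manifolds `ℝ^{l+1} × S^k` and `S^l × ℝ^{k+1}`, which are glued by
`(t x, y) ∼ (x', t⁻¹ y')` for `(x', y') = f (x, y)`, `t > 0`. -/
abbrev Handles : Type := Glued (overlap f)

/-- The closed piece `D^{l+1} × S^k`. -/
def Handles.left (p : Metric.closedBall (0 : V (l + 1)) 1 × S k) : Handles f :=
  Glued.inl (overlap f) (p.1, p.2)

/-- The closed piece `S^l × D^{k+1}`. -/
def Handles.right (p : S l × Metric.closedBall (0 : V (k + 1)) 1) : Handles f :=
  Glued.inr (overlap f) (p.1, p.2)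

/-- The two closed pieces cover the manifold. -/
theorem Handles.exists_left_or_right (p : Handles f) :
    (∃ q, Handles.left f q = p) ∨ ∃ q, Handles.right f q = p := by
  rcases Glued.exists_rep _ p with ⟨⟨v, y⟩, rfl⟩ | ⟨⟨x, w⟩, rfl⟩
  · by_cases hv : ‖v‖ ≤ 1
    · exact .inl ⟨(⟨v, by simpa using hv⟩, y), rfl⟩
    · push Not at hv
      have h0 : v ≠ 0 := norm_pos_iff.1 (by linarith)
      refine .inr ⟨((f (dir v, y)).1, ⟨‖v‖⁻¹ • ((f (dir v, y)).2 : V (k + 1)), ?_⟩), ?_⟩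
      · simp [norm_smul, inv_le_one_of_one_le₀ hv.le]
      · exact (Glued.inl_eq_inr (e := overlap f) (a := (v, y)).2 ⟨h0, rfl⟩).symm
  · by_cases hw : ‖w‖ ≤ 1
    · exact .inr ⟨(x, ⟨w, by simpa using hw⟩), rfl⟩
    · push Not at hw
      have h0 : w ≠ 0 := norm_pos_iff.1 (by linarith)
      refine .inl ⟨(⟨‖w‖⁻¹ • ((f.symm (x, dir w)).1 : V (l + 1)), ?_⟩, (f.symm (x, dir w)).2), ?_⟩
      · simp [norm_smul, inv_le_one_of_one_le₀ hw.le]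
      · refine Glued.inl_eq_inr.2 ⟨(overlap f).map_target (x := (x, w)) h0, ?_⟩
        exact (overlap f).right_inv (x := (x, w)) h0

/-- The two closed pieces meet exactly in their boundaries, identified by `f`. -/
theorem Handles.left_eq_right (p : Metric.closedBall (0 : V (l + 1)) 1 × S k)
    (q : S l × Metric.closedBall (0 : V (k + 1)) 1) :
    Handles.left f p = Handles.right f q ↔
      ∃ (x : S l) (y : S k), (p.1 : V (l + 1)) = x ∧ p.2 = y ∧
        q.1 = (f (x, y)).1 ∧ (q.2 : V (k + 1)) = (f (x, y)).2 := by
  obtain ⟨⟨v, hv⟩, y⟩ := p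
  obtain ⟨x, ⟨w, hw⟩⟩ := q
  simp only [mem_closedBall_zero_iff] at hv hw
  refine Glued.inl_eq_inr.trans ⟨?_, ?_⟩
  · rintro ⟨h0, h⟩
    have h0' : v ≠ 0 := h0
    have h1 : (f (dir v, y)).1 = x := congrArg Prod.fst h
    have h2 : ‖v‖⁻¹ • ((f (dir v, y)).2 : V (k + 1)) = w := congrArg Prod.snd h
    have hpos : 0 < ‖v‖ := norm_pos_iff.2 h0'
    have hn : ‖v‖ = 1 := by
      refine le_antisymm hv ?_
      rw [← h2, norm_smul] at hw
      simp only [norm_inv, norm_norm, norm_eq_of_mem_sphere, mul_one] at hw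
      exact (inv_le_one₀ hpos).1 hw
    refine ⟨dir v, y, ?_, rfl, h1.symm, ?_⟩
    · simp [coe_dir h0', hn]
    · simp [← h2, hn]
  · rintro ⟨x', y', h1, h2, h3, h4⟩
    dsimp only at h1 h2 h3 h4
    subst h1 h2 h3 h4
    refine ⟨?_, ?_⟩
    · change (x' : V (l + 1)) ≠ 0
      rw [← norm_ne_zero_iff]; simp
    · have := dir_smul one_pos x'
      rw [one_smul] at this
      change overlapFun f _ = _
      simp [overlapFun, this]

/-- Identifications of the tangent model spaces of the two pieces with `ℝ^{l+k+1}`. -/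
def modelLeft (l k : ℕ) : (V (l + 1) × V k) ≃L[ℝ] V (l + k + 1) :=
  ContinuousLinearEquiv.ofFinrankEq (by simp; omega)

def modelRight (l k : ℕ) : (V l × V (k + 1)) ≃L[ℝ] V (l + k + 1) :=
  ContinuousLinearEquiv.ofFinrankEq (by simp; omega)

instance : ChartedSpace (V (l + k + 1)) (Handles f) :=
  Glued.chartedSpace (overlap f) (𝓘(ℝ, V (l + 1)).prod (𝓡 k)) (modelLeft l k)
    ((𝓡 l).prod 𝓘(ℝ, V (k + 1))) (modelRight l k)

instance : IsManifold (𝓡 (l + k + 1)) ∞ (Handles f) :=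
  Glued.isManifold (overlap f) (𝓘(ℝ, V (l + 1)).prod (𝓡 k)) (modelLeft l k)
    ((𝓡 l).prod 𝓘(ℝ, V (k + 1))) (modelRight l k)
    (contMDiffOn_overlapFun f) (contMDiffOn_overlapInv f)

end Overlap

/-! ## Rotations -/

/-- The group `SO(n)`, with the topology of a set of matrices. -/
abbrev SO (n : ℕ) : Type := Matrix.specialOrthogonalGroup (Fin n) ℝ

/-- The linear action of `SO(n+1)` on the unit sphere `S^n`. -/
def rotate {n : ℕ} (A : SO (n + 1)) (x : S n) : S n :=
  ⟨WithLp.toLp 2 ((A : Matrix (Fin (n + 1)) (Fin (n + 1)) ℝ) *ᵥ (x : V (n + 1)).ofLp), by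
    have hA : (A : Matrix (Fin (n + 1)) (Fin (n + 1)) ℝ)ᵀ * A = 1 :=
      (Matrix.mem_orthogonalGroup_iff' (Fin (n + 1)) ℝ).1
        (Matrix.mem_specialOrthogonalGroup_iff.1 A.2).1
    rw [mem_sphere_zero_iff_norm]
    refine Eq.trans ?_ (norm_eq_of_mem_sphere x)
    rw [← sq_eq_sq₀ (norm_nonneg _) (norm_nonneg _), ← real_inner_self_eq_norm_sq,
      ← real_inner_self_eq_norm_sq]
    simp only [EuclideanSpace.inner_eq_star_dotProduct, star_trivial]
    rw [Matrix.dotProduct_mulVec, Matrix.vecMul_mulVec, hA, Matrix.vecMul_one]⟩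

theorem rotate_mul {n : ℕ} (A B : SO (n + 1)) (x : S n) :
    rotate (A * B) x = rotate A (rotate B x) := by
  ext1
  simp [rotate, Matrix.mulVec_mulVec]

theorem rotate_one {n : ℕ} (x : S n) : rotate (1 : SO (n + 1)) x = x := by
  ext1
  simp [rotate]

/-- Smooth maps `β : S^k → SO(n)`. Since `SO(n)` is a submanifold of the space of matrices, smooth
means that the matrix entries are smooth. -/
structure SmoothSO (k n : ℕ) where
  toMap : C(S k, SO n)
  smooth : ∀ i j, ContMDiff (𝓡 k) 𝓘(ℝ, ℝ) ∞
    fun y => (toMap y : Matrix (Fin n) (Fin n) ℝ) i j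

theorem contMDiff_rotate {k l : ℕ} {b : S k → SO (l + 1)}
    (hb : ∀ i j, ContMDiff (𝓡 k) 𝓘(ℝ, ℝ) ∞
      fun y => (b y : Matrix (Fin (l + 1)) (Fin (l + 1)) ℝ) i j) :
    ContMDiff ((𝓡 l).prod (𝓡 k)) ((𝓡 l).prod (𝓡 k)) ∞
      (fun p : S l × S k => (rotate (b p.2) p.1, p.2)) := by
  have : Fact (Module.finrank ℝ (V (l + 1)) = l + 1) := ⟨by simp⟩
  refine ContMDiff.prodMk ?_ contMDiff_snd
  have key : ContMDiff ((𝓡 l).prod (𝓡 k)) 𝓘(ℝ, V (l + 1)) ∞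
      (fun p : S l × S k => ((rotate (b p.2) p.1 : S l) : V (l + 1))) := by
    have h1 : ContMDiff ((𝓡 l).prod (𝓡 k)) 𝓘(ℝ, Fin (l + 1) → ℝ) ∞
        (fun p : S l × S k => (b p.2 : Matrix (Fin (l + 1)) (Fin (l + 1)) ℝ) *ᵥ
          (p.1 : V (l + 1)).ofLp) := by
      refine contMDiff_pi_space.2 fun i => ?_
      simp only [Matrix.mulVec, dotProduct]
      refine contMDiff_finsetSum fun j _ => ?_
      refine ((hb i j).comp contMDiff_snd).mul ?_
      exact (EuclideanSpace.proj (𝕜 := ℝ) j).contDiff.contMDiff.comp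
        (contMDiff_coe_sphere.comp contMDiff_fst)
    exact (PiLp.continuousLinearEquiv 2 ℝ (fun _ : Fin (l + 1) => ℝ)).symm.contDiff.contMDiff.comp h1
  exact key.codRestrict_sphere (fun p => (rotate (b p.2) p.1).2)

/-- The diffeomorphism `f_β (x, y) = (β(y) x, y)` of `S^l × S^k`. -/
def twist {k l : ℕ} (β : SmoothSO k (l + 1)) : SphereProdDiffeo l k where
  toFun p := (rotate (β.toMap p.2) p.1, p.2)
  invFun p := (rotate (β.toMap p.2)⁻¹ p.1, p.2)
  left_inv p := by simp [← rotate_mul, rotate_one]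
  right_inv p := by simp [← rotate_mul, rotate_one]
  contMDiff_toFun := contMDiff_rotate β.smooth
  contMDiff_invFun := contMDiff_rotate (b := fun y => (β.toMap y)⁻¹) fun i j => β.smooth j i

/-! ## Homotopy groups and the group `Γ` -/

/-- Maps `(S^k, pole) → (X, x₀)`. -/
abbrev BasedMap (k : ℕ) (X : Type*) [TopologicalSpace X] (x₀ : X) : Type _ :=
  {α : C(S k, X) // α (pole k) = x₀}

instance basedMapSetoid (k : ℕ) (X : Type*) [TopologicalSpace X] (x₀ : X) :
    Setoid (BasedMap k X x₀) where
  r α α' := ContinuousMap.HomotopicRel α.1 α'.1 {pole k}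
  iseqv := ⟨fun _ => .refl _, fun h => h.symm, fun h h' => h.trans h'⟩

/-- The homotopy group `π_k(X, x₀)`, as the set of based homotopy classes of based maps
`S^k → X`. (Its group operation plays no role here.) -/
def PiSphere (k : ℕ) (X : Type*) [TopologicalSpace X] (x₀ : X) : Type _ :=
  Quotient (basedMapSetoid k X x₀)

/-- The map `h_* : π_k(X, x₀) → π_k(Y, y₀)` induced by a continuous map `h` with `h x₀ = y₀`. -/
def PiSphere.map {k : ℕ} {X Y : Type*} [TopologicalSpace X] [TopologicalSpace Y] {x₀ : X} {y₀ : Y}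
    (h : C(X, Y)) (hx : h x₀ = y₀) : PiSphere k X x₀ → PiSphere k Y y₀ :=
  Quotient.map (fun α => ⟨h.comp α.1, by simp [α.2, hx]⟩)
    fun _ _ hα => hα.comp_continuousMap h

/-- The smooth map `β` represents the element `c` of `π_k(SO(n), 1)`. -/
def SmoothSO.Represents {k n : ℕ} (β : SmoothSO k n) (c : PiSphere k (SO n) 1) : Prop :=
  ∃ h : β.toMap (pole k) = 1, Quotient.mk (basedMapSetoid k (SO n) 1) ⟨β.toMap, h⟩ = c

/-- Diffeomorphisms of `S^n`. -/
abbrev SphereDiffeo (n : ℕ) : Type := S n ≃ₘ⟮𝓡 n, 𝓡 n⟯ S n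

/-- The map `ψ : S^n → S^n` extends to a diffeomorphism of the closed disc `D^{n+1}`. -/
def ExtendsToDisc {n : ℕ} (ψ : S n → S n) : Prop :=
  ∃ Ψ Ψ' : V (n + 1) → V (n + 1),
    ContDiffOn ℝ ∞ Ψ (Metric.closedBall 0 1) ∧ ContDiffOn ℝ ∞ Ψ' (Metric.closedBall 0 1) ∧
    Set.MapsTo Ψ (Metric.closedBall 0 1) (Metric.closedBall 0 1) ∧
    Set.MapsTo Ψ' (Metric.closedBall 0 1) (Metric.closedBall 0 1) ∧
    Set.InvOn Ψ' Ψ (Metric.closedBall 0 1) (Metric.closedBall 0 1) ∧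
    ∀ x : S n, Ψ x = ψ x

instance gammaSetoid (n : ℕ) : Setoid (SphereDiffeo n) where
  r φ φ' := ExtendsToDisc (φ.symm ∘ φ')
  iseqv := by
    refine ⟨fun φ => ?_, ?_, ?_⟩
    · exact ⟨id, id, contDiffOn_id, contDiffOn_id, Set.mapsTo_id _, Set.mapsTo_id _,
        ⟨fun _ _ => rfl, fun _ _ => rfl⟩, by simp⟩
    · rintro φ φ' ⟨Ψ, Ψ', h1, h2, h3, h4, h5, h6⟩
      refine ⟨Ψ', Ψ, h2, h1, h4, h3, h5.symm, fun x => ?_⟩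
      have := h6 (φ'.symm (φ x))
      simp only [Function.comp_apply, Diffeomorph.apply_symm_apply,
        Diffeomorph.symm_apply_apply] at this
      rw [← this, h5.1]
      · rfl
      · exact Metric.sphere_subset_closedBall (φ'.symm (φ x)).2
    · rintro φ φ' φ'' ⟨Ψ, Ψ', h1, h2, h3, h4, h5, h6⟩ ⟨Θ, Θ', g1, g2, g3, g4, g5, g6⟩
      refine ⟨Ψ ∘ Θ, Θ' ∘ Ψ', h1.comp g1 g3, g2.comp h2 h4, h3.comp g3, g4.comp h4,
        g5.comp h5 g3 h4, fun x => ?_⟩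
      simp [g6, h6]

/-- The group `Γ^{n+1}`, as the set of cosets of the diffeomorphisms of `S^n` modulo those that
extend to the disc `D^{n+1}`. (As reflections extend to the disc, each coset contains orientation
preserving diffeomorphisms, and this is the same as the quotient of the orientation preserving
diffeomorphisms by those that extend to the disc.) -/
def Gamma (n : ℕ) : Type := Quotient (gammaSetoid n)

/-- The class `[φ]`. -/
def Gamma.mk {n : ℕ} (φ : SphereDiffeo n) : Gamma n := Quotient.mk (gammaSetoid n) φ

/-! ## The pairing -/

/-- The manifold `D^{l+1} × S^k ∪_{f_β (φ × id)} S^l × D^{k+1}`, which for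
`φ : S^l → S^l` and `β : S^k → SO(l+1)` represents `τ([φ], [β])`. -/
abbrev TauManifold {l k : ℕ} (φ : SphereDiffeo l) (β : SmoothSO k (l + 1)) : Type :=
  Handles ((φ.prodCongr (Diffeomorph.refl (𝓡 k) (S k) ∞)).trans (twist β))

/-- `τ(a, c) = 0`, for `a ∈ Γ^{l+1}` and `c ∈ π_k SO(l+1)`: the element `c` has smooth
representatives, and for all representatives `φ` of `a` and all smooth representatives `β` of `c`
the manifold `D^{l+1} × S^k ∪_{f_β (φ × id)} S^l × D^{k+1}` is diffeomorphic to the standard sphere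
`S^{l+k+1}`. -/
def TauEqZero {l k : ℕ} (a : Gamma l) (c : PiSphere k (SO (l + 1)) 1) : Prop :=
  (∃ β : SmoothSO k (l + 1), β.Represents c) ∧
  ∀ (φ : SphereDiffeo l) (β : SmoothSO k (l + 1)), Gamma.mk φ = a → β.Represents c →
    Nonempty (TauManifold φ β ≃ₘ⟮𝓡 (l + k + 1), 𝓡 (l + k + 1)⟯ S (l + k + 1))

end TauPairing

end

/-! The standard sphere is `D^{l+1} × S^k ∪_id S^l × D^{k+1}`, and a gluing keeps its diffeomorphism
type when the gluing map is composed with diffeomorphisms that extend over one of the pieces. Let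
`φ'` represent `[φ]` and `β` represent `Δ_* c`. Composing the gluing map `(x, y) ↦ (β(y) φ'(x), y)`
with `φ⁻¹ × id`, which extends over `S^l × D^{k+1}`, leaves the family `φ⁻¹ β(y) φ' = (φ⁻¹ β(y) φ) ∘
(φ⁻¹ φ')`. It suffices to extend this to a smooth family of diffeomorphisms of the disc.

The right factor is independent of `y` and extends because `[φ'] = [φ]`. For the left factor, let
`α` be `Δ` composed with a representative of `c`. Equivariance gives `φ⁻¹ α(y) φ = α(y)`, which is
linear and so extends. But `α` is merely continuous, and merely homotopic to `β`. Hence one takes a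
smooth family `g(t, y)` of invertible linear maps, acting on directions, with `g(0, y)` close to
`α(y)` and `g(1, y) = β(y)` (`exists_smooth_homotopy`). For `A` near the commuting rotations `φ⁻¹ A
φ` still extends, by openness of invertibility (`exists_extension_near_commuting`). The remaining
isotopy from `g(0, y)` to `β(y)` is spread over the spheres of radius between 1 and 2
(`levelTwist`).

Discs are replaced by `ℝ^{l+1}`, with maps that are radial, that is, norm preserving and positively
homogeneous, outside a ball; `nonempty_diffeo_sphere` is the recognition criterion in this form. To
reach it, a diffeomorphism of the closed disc is made radial near the boundary
(`ExtendsToDisc.exists_radial_extension`), and maps built by interpolation are inverted by means of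
`bijective_of_eq_radial` and `exists_family_inverse`. That `Δ_* c` has smooth representatives at all
follows from Gram–Schmidt (`exists_smooth_representative`). -/

noncomputable section

namespace TauPairing

/-! ## Smooth maps into and out of glued manifolds -/

section ChartTransport

variable {E H F X M : Type*} [NormedAddCommGroup E] [NormedSpace ℝ E] [TopologicalSpace H]
  [NormedAddCommGroup F] [NormedSpace ℝ F] [TopologicalSpace X] [TopologicalSpace M]
  {I : ModelWithCorners ℝ E H} [ChartedSpace H X] [ChartedSpace F M] [IsManifold 𝓘(ℝ, F) ∞ M]
  {j : X → M} {χ : OpenPartialHomeomorph X F} {c : OpenPartialHomeomorph M F}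

/-- A map that carries a smooth chart to a chart of the atlas is smooth there. -/
theorem contMDiffOn_of_chart_comp (hc : c ∈ atlas F M)
    (hχ : ContMDiffOn I 𝓘(ℝ, F) ∞ χ χ.source)
    (hs : ∀ x ∈ χ.source, j x ∈ c.source) (hj : ∀ x ∈ χ.source, c (j x) = χ x) :
    ContMDiffOn I 𝓘(ℝ, F) ∞ j χ.source := by
  have h1 := contMDiffOn_symm_of_mem_maximalAtlas (I := 𝓘(ℝ, F)) (n := ∞)
    (IsManifold.subset_maximalAtlas hc)
  refine (h1.comp hχ fun x hx => ?_).congr fun x hx => ?_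
  · exact (congrArg (· ∈ c.target) (hj x hx)).mp (c.map_source (hs x hx))
  · rw [Function.comp_apply, ← hj x hx, c.left_inv (hs x hx)]

/-- A map out of `M` is smooth at `j a` if its composition with `j` is smooth at `a`, when `j`
carries a smooth chart at `a` to a chart of the atlas. -/
theorem contMDiffAt_of_comp_chart {E' H' N : Type*} [NormedAddCommGroup E'] [NormedSpace ℝ E']
    [TopologicalSpace H'] {I' : ModelWithCorners ℝ E' H'} [TopologicalSpace N] [ChartedSpace H' N]
    (hc : c ∈ atlas F M) (hχ : ContMDiffOn 𝓘(ℝ, F) I ∞ χ.symm χ.target)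
    (hs : c.source ⊆ j '' χ.source) (hj : ∀ x ∈ χ.source, c (j x) = χ x) {g : M → N} {a : X}
    (ha : a ∈ χ.source) (hja : j a ∈ c.source) (hg : ContMDiffAt I I' ∞ (g ∘ j) a) :
    ContMDiffAt 𝓘(ℝ, F) I' ∞ g (j a) := by
  have h1 := contMDiffOn_of_mem_maximalAtlas (I := 𝓘(ℝ, F)) (n := ∞)
    (IsManifold.subset_maximalAtlas hc)
  have h2 : ContMDiffOn 𝓘(ℝ, F) I ∞ (χ.symm ∘ c) c.source := by
    refine hχ.comp h1 fun p hp => ?_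
    obtain ⟨x, hx, rfl⟩ := hs hp
    exact (congrArg (· ∈ χ.target) (hj x hx)).mpr (χ.map_source hx)
  have h3 : (χ.symm ∘ c) (j a) = a := by simp [hj a ha, χ.left_inv ha]
  have h4 : ContMDiffAt 𝓘(ℝ, F) I' ∞ ((g ∘ j) ∘ (χ.symm ∘ c)) (j a) :=
    ContMDiffAt.comp (j a) (h3.symm ▸ hg) (h2.contMDiffAt (c.open_source.mem_nhds hja))
  refine h4.congr_of_eventuallyEq ?_
  filter_upwards [c.open_source.mem_nhds hja] with p hp
  obtain ⟨x, hx, rfl⟩ := hs hp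
  simp [hj x hx, χ.left_inv hx]

end ChartTransport

/-! ### Charts of the pieces, read in the glued space -/

section LiftedCharts

variable {A B F : Type*} [TopologicalSpace A] [TopologicalSpace B] [TopologicalSpace F]
  (e : OpenPartialHomeomorph A B)

theorem Glued.liftl_inl [Nonempty A] (χ : OpenPartialHomeomorph A F) (x : A) :
    Glued.liftl e χ (Glued.inl e x) = χ x := by
  have h := ((Glued.isOpenEmbedding_inl e).toOpenPartialHomeomorph (Glued.inl e)).left_inv
    (x := x) (by simp)
  exact congrArg χ h

theorem Glued.liftr_inr [Nonempty B] (χ : OpenPartialHomeomorph B F) (x : B) :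
    Glued.liftr e χ (Glued.inr e x) = χ x := by
  have h := ((Glued.isOpenEmbedding_inr e).toOpenPartialHomeomorph (Glued.inr e)).left_inv
    (x := x) (by simp)
  exact congrArg χ h

theorem Glued.liftl_source [Nonempty A] (χ : OpenPartialHomeomorph A F) :
    (Glued.liftl e χ).source = Glued.inl e '' χ.source := by
  have h (x : A) := ((Glued.isOpenEmbedding_inl e).toOpenPartialHomeomorph (Glued.inl e)).left_inv
    (x := x) (by simp)
  simp only [Topology.IsOpenEmbedding.toOpenPartialHomeomorph_apply] at h
  ext p
  simp only [Glued.liftl, OpenPartialHomeomorph.trans_source, OpenPartialHomeomorph.symm_source,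
    Topology.IsOpenEmbedding.toOpenPartialHomeomorph_target, Set.mem_inter_iff, Set.mem_preimage,
    Set.mem_range, Set.mem_image]
  constructor
  · rintro ⟨⟨x, rfl⟩, hx⟩
    exact ⟨x, by rwa [h] at hx, rfl⟩
  · rintro ⟨x, hx, rfl⟩
    exact ⟨⟨x, rfl⟩, by rwa [h]⟩

theorem Glued.liftr_source [Nonempty B] (χ : OpenPartialHomeomorph B F) :
    (Glued.liftr e χ).source = Glued.inr e '' χ.source := by
  have h (x : B) := ((Glued.isOpenEmbedding_inr e).toOpenPartialHomeomorph (Glued.inr e)).left_inv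
    (x := x) (by simp)
  simp only [Topology.IsOpenEmbedding.toOpenPartialHomeomorph_apply] at h
  ext p
  simp only [Glued.liftr, OpenPartialHomeomorph.trans_source, OpenPartialHomeomorph.symm_source,
    Topology.IsOpenEmbedding.toOpenPartialHomeomorph_target, Set.mem_inter_iff, Set.mem_preimage,
    Set.mem_range, Set.mem_image]
  constructor
  · rintro ⟨⟨x, rfl⟩, hx⟩
    exact ⟨x, by rwa [h] at hx, rfl⟩
  · rintro ⟨x, hx, rfl⟩
    exact ⟨⟨x, rfl⟩, by rwa [h]⟩

end LiftedCharts

/-! ### Smoothness on `Handles f`, tested on the two pieces -/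

section HandlesSmooth

variable {l k : ℕ} (f : SphereProdDiffeo l k)

theorem Handles.contMDiff_inl :
    ContMDiff (𝓘(ℝ, V (l + 1)).prod (𝓡 k)) (𝓡 (l + k + 1)) ∞ (Glued.inl (overlap f)) := by
  intro a
  let χ := flatChart (𝓘(ℝ, V (l + 1)).prod (𝓡 k)) (modelLeft l k) a
  refine (contMDiffOn_of_chart_comp (χ := χ) (c := Glued.liftl (overlap f) χ) (Or.inl ⟨a, rfl⟩)
    (contMDiffOn_flatChart _ _ a) (fun x hx => ?_) fun x _ => Glued.liftl_inl _ _ x).contMDiffAt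
    (χ.open_source.mem_nhds (mem_flatChart_source _ _ a))
  rw [Glued.liftl_source]; exact ⟨x, hx, rfl⟩

theorem Handles.contMDiff_inr :
    ContMDiff ((𝓡 l).prod 𝓘(ℝ, V (k + 1))) (𝓡 (l + k + 1)) ∞ (Glued.inr (overlap f)) := by
  intro a
  let χ := flatChart ((𝓡 l).prod 𝓘(ℝ, V (k + 1))) (modelRight l k) a
  refine (contMDiffOn_of_chart_comp (χ := χ) (c := Glued.liftr (overlap f) χ) (Or.inr ⟨a, rfl⟩)
    (contMDiffOn_flatChart _ _ a) (fun x hx => ?_) fun x _ => Glued.liftr_inr _ _ x).contMDiffAt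
    (χ.open_source.mem_nhds (mem_flatChart_source _ _ a))
  rw [Glued.liftr_source]; exact ⟨x, hx, rfl⟩

/-- A map out of `Handles f` is smooth if it is smooth on both pieces. -/
theorem Handles.contMDiff_of_comp {E' H' N : Type*} [NormedAddCommGroup E'] [NormedSpace ℝ E']
    [TopologicalSpace H'] {I' : ModelWithCorners ℝ E' H'} [TopologicalSpace N] [ChartedSpace H' N]
    {g : Handles f → N}
    (hl : ContMDiff (𝓘(ℝ, V (l + 1)).prod (𝓡 k)) I' ∞ (g ∘ Glued.inl (overlap f)))
    (hr : ContMDiff ((𝓡 l).prod 𝓘(ℝ, V (k + 1))) I' ∞ (g ∘ Glued.inr (overlap f))) :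
    ContMDiff (𝓡 (l + k + 1)) I' ∞ g := by
  intro p
  rcases Glued.exists_rep _ p with ⟨a, rfl⟩ | ⟨b, rfl⟩
  · let χ := flatChart (𝓘(ℝ, V (l + 1)).prod (𝓡 k)) (modelLeft l k) a
    have hs := Glued.liftl_source (overlap f) χ
    have ha : a ∈ χ.source := mem_flatChart_source _ _ a
    exact contMDiffAt_of_comp_chart (χ := χ) (c := Glued.liftl (overlap f) χ) (Or.inl ⟨a, rfl⟩)
      (contMDiffOn_flatChart_symm _ _ a) hs.subset (fun x _ => Glued.liftl_inl _ _ x) ha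
      (hs ▸ ⟨a, ha, rfl⟩) (hl a)
  · let χ := flatChart ((𝓡 l).prod 𝓘(ℝ, V (k + 1))) (modelRight l k) b
    have hs := Glued.liftr_source (overlap f) χ
    have hb : b ∈ χ.source := mem_flatChart_source _ _ b
    exact contMDiffAt_of_comp_chart (χ := χ) (c := Glued.liftr (overlap f) χ) (Or.inr ⟨b, rfl⟩)
      (contMDiffOn_flatChart_symm _ _ b) hs.subset (fun x _ => Glued.liftr_inr _ _ x) hb
      (hs ▸ ⟨b, hb, rfl⟩) (hr b)

end HandlesSmooth

/-! ## Recognizing the standard sphere -/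

/-- At `v = 0` both sides are the default value of `dir`, so no condition on `v` is needed. -/
theorem dir_smul_of_pos {n : ℕ} {t : ℝ} (ht : 0 < t) (v : V (n + 1)) : dir (t • v) = dir v := by
  by_cases h : v = 0
  · simp [h]
  · have h' : t • v ≠ 0 := smul_ne_zero ht.ne' h
    ext1
    rw [coe_dir h', coe_dir h, norm_smul, Real.norm_of_nonneg ht.le, smul_smul, mul_inv,
      mul_right_comm, inv_mul_cancel₀ ht.ne', one_mul]

theorem dir_coe {n : ℕ} (x : S n) : dir (x : V (n + 1)) = x := by
  simpa using dir_smul one_pos x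

theorem norm_smul_dir {n : ℕ} (v : V (n + 1)) : ‖v‖ • (dir v : V (n + 1)) = v := by
  by_cases h : v = 0
  · simp [h]
  · rw [coe_dir h, smul_smul, mul_inv_cancel₀ (norm_ne_zero_iff.2 h), one_smul]

theorem coe_ne_zero {n : ℕ} (x : S n) : (x : V (n + 1)) ≠ 0 := by
  rw [← norm_ne_zero_iff]; simp

theorem norm_smul_coe {n : ℕ} {t : ℝ} (ht : 0 ≤ t) (x : S n) : ‖t • (x : V (n + 1))‖ = t := by
  simp [norm_smul, abs_of_nonneg ht]

section Recognition

variable {l k : ℕ} {f : SphereProdDiffeo l k}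

theorem symm_snd_of_snd (hf : ∀ p, (f p).2 = p.2) (p : S l × S k) : (f.symm p).2 = p.2 := by
  have := hf (f.symm p)
  rw [Diffeomorph.apply_symm_apply] at this
  exact this.symm

/-- A linear identification of `ℝ^{l+1} × ℝ^{k+1}` with `ℝ^{l+k+2}`. -/
def prodModel (l k : ℕ) : (V (l + 1) × V (k + 1)) ≃L[ℝ] V (l + k + 1 + 1) :=
  ContinuousLinearEquiv.ofFinrankEq (by simp; omega)

variable (f) (φ : SphereDiffeo l) (F F' : V (l + 1) × S k → V (l + 1))

/-- The map `ℝ^{l+1} × S^k → S^{l+k+1}` defined by a family of self-maps of `ℝ^{l+1}`. -/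
def toSphereLeft (p : V (l + 1) × S k) : S (l + k + 1) :=
  dir (prodModel l k (F p, (p.2 : V (k + 1))))

-- The sphere is treated as the space of rays of `ℝ^{l+1} × ℝ^{k+1}`; since `prodModel` is only
-- linear, `dir` does the normalization. On the core `w = 0` the value is the limit of the
-- neighbouring rays when `F` is radial at infinity.
open Classical in
def toSphereRight (p : S l × V (k + 1)) : S (l + k + 1) :=
  if p.2 = 0 then dir (prodModel l k ((φ.symm p.1 : V (l + 1)), 0))
  else toSphereLeft F (overlapInv f p)

def toSphere : Handles f → S (l + k + 1) :=
  Quotient.lift (Sum.elim (toSphereLeft F) (toSphereRight f φ F)) <| by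
    have key (a : V (l + 1) × S k) (b : S l × V (k + 1)) (h : a ∈ (overlap f).source ∧
        overlap f a = b) : toSphereLeft F a = toSphereRight f φ F b := by
      obtain ⟨h, rfl⟩ := h
      have h2 : (overlap f a).2 ≠ 0 := (overlap f).map_source h
      rw [toSphereRight, if_neg h2]
      exact congrArg (toSphereLeft F) ((overlap f).left_inv h).symm
    rintro (a | b) (a' | b') h
    · exact congrArg (toSphereLeft F) h
    · exact key a b' h
    · exact (key a' b h).symm
    · exact congrArg (toSphereRight f φ F) h

-- A ray with nonzero second component is scaled until that component is a unit vector, and `F'`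
-- then undoes `F`. The rays with zero second component form the core `S^l × 0`.
open Classical in
def ofSphere (p : S (l + k + 1)) : Handles f :=
  let q := (prodModel l k).symm p
  if q.2 = 0 then Glued.inr (overlap f) (φ (dir q.1), 0)
  else Glued.inl (overlap f) (F' (‖q.2‖⁻¹ • q.1, dir q.2), dir q.2)

variable {f φ F F'}

/-- The point `(x, w)` lies at radius `‖w‖⁻¹ ≥ 2` in the left piece, where `F` is explicit; scaling
the ray by `‖w‖` cancels every singular factor. The resulting formula is smooth across `w = 0`. -/
theorem toSphereRight_eq (hf : ∀ p, (f p).2 = p.2)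
    (hF : ∀ v y, 2 ≤ ‖v‖ → F (v, y) = ‖v‖ • (φ.symm (f (dir v, y)).1 : V (l + 1)))
    {p : S l × V (k + 1)} (hp : ‖p.2‖ ≤ 1 / 2) :
    toSphereRight f φ F p = dir (prodModel l k ((φ.symm p.1 : V (l + 1)), p.2)) := by
  obtain ⟨x, w⟩ := p
  by_cases hw : w = 0
  · simp [toSphereRight, hw]
  have hpos : 0 < ‖w‖ := norm_pos_iff.2 hw
  have hinv : 0 < ‖w‖⁻¹ := inv_pos.2 hpos
  have h2 : (2 : ℝ) ≤ ‖w‖⁻¹ := by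
    rw [le_inv_comm₀ two_pos hpos]; simpa using hp
  have hs : (f.symm (x, dir w)).2 = dir w := symm_snd_of_snd hf _
  have hfs : f ((f.symm (x, dir w)).1, dir w) = (x, dir w) := by
    conv_lhs => rw [show ((f.symm (x, dir w)).1, dir w) = f.symm (x, dir w) from Prod.ext rfl hs.symm]
    exact f.apply_symm_apply _
  simp only [toSphereRight, hw, if_false, toSphereLeft, overlapInv, hs]
  rw [hF _ _ (by rw [norm_smul_coe hinv.le]; exact h2), norm_smul_coe hinv.le,
    dir_smul_of_pos hinv, dir_coe, hfs, coe_dir hw]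
  rw [show (‖w‖⁻¹ • (φ.symm x : V (l + 1)), ‖w‖⁻¹ • w) = ‖w‖⁻¹ • ((φ.symm x : V (l + 1)), w) from rfl,
    map_smul, dir_smul_of_pos hinv]

/-- Apply `hl` to the claimed value: it has the same norm as `u`, so `F` is explicit there and sends
it to `u`. -/
theorem eq_of_two_le_norm (hf : ∀ p, (f p).2 = p.2)
    (hF : ∀ v y, 2 ≤ ‖v‖ → F (v, y) = ‖v‖ • (φ.symm (f (dir v, y)).1 : V (l + 1)))
    (hl : ∀ v y, F' (F (v, y), y) = v) (u : V (l + 1)) (y : S k) (hu : 2 ≤ ‖u‖) :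
    F' (u, y) = ‖u‖ • ((f.symm (φ (dir u), y)).1 : V (l + 1)) := by
  have hpos : 0 < ‖u‖ := by linarith
  have hs : (f.symm (φ (dir u), y)).2 = y := symm_snd_of_snd hf _
  have hfs : f ((f.symm (φ (dir u), y)).1, y) = (φ (dir u), y) := by
    conv_lhs => rw [show ((f.symm (φ (dir u), y)).1, y) = f.symm (φ (dir u), y)
      from Prod.ext rfl hs.symm]
    exact f.apply_symm_apply _
  have h1 := hF (‖u‖ • ((f.symm (φ (dir u), y)).1 : V (l + 1))) y
    (by rw [norm_smul_coe hpos.le]; exact hu)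
  rw [norm_smul_coe hpos.le, dir_smul_of_pos hpos, dir_coe, hfs, φ.symm_apply_apply,
    norm_smul_dir] at h1
  rw [← hl (‖u‖ • ((f.symm (φ (dir u), y)).1 : V (l + 1))) y, h1]

/-- The bound `h2` puts the left coordinate at radius at least 2, where `F'` is explicit, and the
point can be moved across `overlap`. The formula stays smooth where the second component vanishes.
-/
theorem ofSphere_eq (hf : ∀ p, (f p).2 = p.2)
    (hF : ∀ v y, 2 ≤ ‖v‖ → F (v, y) = ‖v‖ • (φ.symm (f (dir v, y)).1 : V (l + 1)))
    (hl : ∀ v y, F' (F (v, y), y) = v) {p : S (l + k + 1)}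
    (h1 : ((prodModel l k).symm p).1 ≠ 0)
    (h2 : 2 * ‖((prodModel l k).symm p).2‖ ≤ ‖((prodModel l k).symm p).1‖) :
    ofSphere f φ F' p = Glued.inr (overlap f) (φ (dir ((prodModel l k).symm p).1),
      ‖((prodModel l k).symm p).1‖⁻¹ • ((prodModel l k).symm p).2) := by
  simp only [ofSphere]
  set q := (prodModel l k).symm p
  obtain ⟨v, w⟩ := q
  dsimp only at h1 h2 ⊢
  by_cases hw : w = 0
  · simp [hw]
  have hpos : 0 < ‖w‖ := norm_pos_iff.2 hw
  have hvpos : 0 < ‖v‖ := norm_pos_iff.2 h1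
  have hinv : 0 < ‖w‖⁻¹ := inv_pos.2 hpos
  have hn : ‖‖w‖⁻¹ • v‖ = ‖w‖⁻¹ * ‖v‖ := by rw [norm_smul, Real.norm_of_nonneg hinv.le]
  have hnpos : 0 < ‖w‖⁻¹ * ‖v‖ := by positivity
  rw [if_neg hw, eq_of_two_le_norm hf hF hl, hn, dir_smul_of_pos hinv]
  · refine Glued.inl_eq_inr.2 ⟨smul_ne_zero hnpos.ne' (coe_ne_zero _), ?_⟩
    have hs : (f.symm (φ (dir v), dir w)).2 = dir w := symm_snd_of_snd hf _
    have hfs : f ((f.symm (φ (dir v), dir w)).1, dir w) = (φ (dir v), dir w) := by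
      conv_lhs => rw [show ((f.symm (φ (dir v), dir w)).1, dir w) = f.symm (φ (dir v), dir w)
        from Prod.ext rfl hs.symm]
      exact f.apply_symm_apply _
    change overlapFun f _ = _
    simp only [overlapFun, norm_smul_coe hnpos.le, dir_smul_of_pos hnpos, dir_coe, hfs]
    refine Prod.ext rfl ?_
    dsimp only
    rw [coe_dir hw, smul_smul]
    congr 1
    field_simp
  · rw [hn, ← div_eq_inv_mul, le_div_iff₀ hpos]
    exact h2

theorem prodModel_coe_ne_zero (p : V (l + 1) × S k) :
    prodModel l k (p.1, (p.2 : V (k + 1))) ≠ 0 := by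
  intro h
  rw [map_eq_zero_iff _ (prodModel l k).injective] at h
  exact coe_ne_zero p.2 (congrArg Prod.snd h)

theorem prodModel_ne_zero_of_coe (p : S l × V (k + 1)) :
    prodModel l k ((p.1 : V (l + 1)), p.2) ≠ 0 := by
  intro h
  rw [map_eq_zero_iff _ (prodModel l k).injective] at h
  exact coe_ne_zero p.1 (congrArg Prod.fst h)

theorem ofSphere_toSphereLeft (hl : ∀ v y, F' (F (v, y), y) = v) (p : V (l + 1) × S k) :
    ofSphere f φ F' (toSphereLeft F p) = Glued.inl (overlap f) p := by
  obtain ⟨v, y⟩ := p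
  have h0 := prodModel_coe_ne_zero (F (v, y), y)
  have ht := inv_pos.2 (norm_pos_iff.2 h0)
  set t := ‖prodModel l k (F (v, y), (y : V (k + 1)))‖⁻¹ with htd
  have hq : (prodModel l k).symm (toSphereLeft F (v, y) : V (l + k + 1 + 1)) =
      (t • F (v, y), t • (y : V (k + 1))) := by
    rw [toSphereLeft, coe_dir h0, ← htd, map_smul, ContinuousLinearEquiv.symm_apply_apply]
    rfl
  simp only [ofSphere, hq]
  rw [if_neg (smul_ne_zero ht.ne' (coe_ne_zero y)), norm_smul_coe ht.le, smul_smul,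
    inv_mul_cancel₀ ht.ne', one_smul, dir_smul_of_pos ht, dir_coe, hl]

theorem ofSphere_toSphere (hl : ∀ v y, F' (F (v, y), y) = v) (p : Handles f) :
    ofSphere f φ F' (toSphere f φ F p) = p := by
  rcases Glued.exists_rep _ p with ⟨a, rfl⟩ | ⟨⟨x, w⟩, rfl⟩
  · exact ofSphere_toSphereLeft hl a
  · change ofSphere f φ F' (toSphereRight f φ F (x, w)) = _
    by_cases hw : w = 0
    · subst hw
      have h0 := prodModel_ne_zero_of_coe (k := k) (φ.symm x, 0)
      have ht := inv_pos.2 (norm_pos_iff.2 h0)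
      set t := ‖prodModel l k ((φ.symm x : V (l + 1)), 0)‖⁻¹ with htd
      have hq : (prodModel l k).symm (toSphereRight f φ F (x, 0) : V (l + k + 1 + 1)) =
          (t • (φ.symm x : V (l + 1)), 0) := by
        rw [toSphereRight, if_pos rfl, coe_dir h0, ← htd, map_smul,
          ContinuousLinearEquiv.symm_apply_apply, Prod.smul_mk, smul_zero]
      simp only [ofSphere, hq]
      rw [if_pos trivial, dir_smul_of_pos ht, dir_coe, φ.apply_symm_apply]
    · rw [toSphereRight, if_neg hw, ofSphere_toSphereLeft hl]
      exact Glued.inl_eq_inr.2 ⟨(overlap f).map_target (x := (x, w)) hw,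
        (overlap f).right_inv (x := (x, w)) hw⟩

theorem toSphere_ofSphere (hr : ∀ v y, F (F' (v, y), y) = v) (p : S (l + k + 1)) :
    toSphere f φ F (ofSphere f φ F' p) = p := by
  simp only [ofSphere]
  have hp : prodModel l k ((prodModel l k).symm (p : V (l + k + 1 + 1))) = p :=
    ContinuousLinearEquiv.apply_symm_apply _ _
  have hp0 := coe_ne_zero p
  set q := (prodModel l k).symm (p : V (l + k + 1 + 1))
  obtain ⟨v, w⟩ := q
  dsimp only
  split_ifs with hw
  · subst hw
    have hv : v ≠ 0 := by
      rintro rfl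
      rw [show ((0 : V (l + 1)), (0 : V (k + 1))) = 0 from rfl, map_zero] at hp
      exact hp0 hp.symm
    change toSphereRight f φ F (φ (dir v), 0) = p
    rw [toSphereRight, if_pos rfl]
    dsimp only
    rw [φ.symm_apply_apply, coe_dir hv,
      show (‖v‖⁻¹ • v, (0 : V (k + 1))) = ‖v‖⁻¹ • (v, (0 : V (k + 1))) by simp,
      map_smul, hp, dir_smul (inv_pos.2 (norm_pos_iff.2 hv))]
  · change toSphereLeft F (F' (‖w‖⁻¹ • v, dir w), dir w) = p
    rw [toSphereLeft, hr, coe_dir hw, show (‖w‖⁻¹ • v, ‖w‖⁻¹ • w) = ‖w‖⁻¹ • (v, w) from rfl,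
      map_smul, hp, dir_smul (inv_pos.2 (norm_pos_iff.2 hw))]

theorem contMDiff_toSphereLeft
    (hF : ContMDiff (𝓘(ℝ, V (l + 1)).prod (𝓡 k)) 𝓘(ℝ, V (l + 1)) ∞ F) :
    ContMDiff (𝓘(ℝ, V (l + 1)).prod (𝓡 k)) (𝓡 (l + k + 1)) ∞ (toSphereLeft F) := by
  have : Fact (Module.finrank ℝ (V (k + 1)) = k + 1) := ⟨by simp⟩
  have h1 : ContMDiff (𝓘(ℝ, V (l + 1)).prod (𝓡 k)) 𝓘(ℝ, V (l + 1) × V (k + 1)) ∞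
      (fun p : V (l + 1) × S k => (F p, (p.2 : V (k + 1)))) :=
    hF.prodMk_space (contMDiff_coe_sphere.comp contMDiff_snd)
  exact (contMDiffOn_dir (l + k + 1)).comp_contMDiff
    ((prodModel l k).contDiff.contMDiff.comp h1) fun p => prodModel_coe_ne_zero (F p, p.2)

theorem contMDiff_toSphere (hf : ∀ p, (f p).2 = p.2)
    (hs : ContMDiff (𝓘(ℝ, V (l + 1)).prod (𝓡 k)) 𝓘(ℝ, V (l + 1)) ∞ F)
    (hF : ∀ v y, 2 ≤ ‖v‖ → F (v, y) = ‖v‖ • (φ.symm (f (dir v, y)).1 : V (l + 1))) :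
    ContMDiff (𝓡 (l + k + 1)) (𝓡 (l + k + 1)) ∞ (toSphere f φ F) := by
  have : Fact (Module.finrank ℝ (V (l + 1)) = l + 1) := ⟨by simp⟩
  refine Handles.contMDiff_of_comp f (contMDiff_toSphereLeft hs) ?_
  change ContMDiff _ _ ∞ (toSphereRight f φ F)
  intro p
  by_cases hp : p.2 = 0
  · have h1 : ContMDiff ((𝓡 l).prod 𝓘(ℝ, V (k + 1))) 𝓘(ℝ, V (l + 1) × V (k + 1)) ∞
        (fun p : S l × V (k + 1) => ((φ.symm p.1 : V (l + 1)), p.2)) :=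
      (contMDiff_coe_sphere.comp (φ.symm.contMDiff.comp contMDiff_fst)).prodMk_space contMDiff_snd
    have h2 : ContMDiff ((𝓡 l).prod 𝓘(ℝ, V (k + 1))) (𝓡 (l + k + 1)) ∞
        (fun p : S l × V (k + 1) => dir (prodModel l k ((φ.symm p.1 : V (l + 1)), p.2))) :=
      (contMDiffOn_dir (l + k + 1)).comp_contMDiff ((prodModel l k).contDiff.contMDiff.comp h1)
        fun p => prodModel_ne_zero_of_coe (φ.symm p.1, p.2)
    refine (h2 p).congr_of_eventuallyEq ?_
    have ho : IsOpen {p : S l × V (k + 1) | ‖p.2‖ < 1 / 2} :=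
      isOpen_lt continuous_snd.norm continuous_const
    filter_upwards [ho.mem_nhds (by simp [hp])] with q hq
    exact toSphereRight_eq hf hF (le_of_lt hq)
  · have ho : IsOpen {p : S l × V (k + 1) | p.2 ≠ 0} := isOpen_ne.preimage continuous_snd
    have h1 : ContMDiffAt ((𝓡 l).prod 𝓘(ℝ, V (k + 1))) (𝓡 (l + k + 1)) ∞
        (toSphereLeft F ∘ overlapInv f) p :=
      ((contMDiff_toSphereLeft hs).comp_contMDiffOn (contMDiffOn_overlapInv f)).contMDiffAt
        (ho.mem_nhds hp)
    refine h1.congr_of_eventuallyEq ?_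
    filter_upwards [ho.mem_nhds hp] with q hq
    exact if_neg hq

theorem contMDiff_ofSphere (hf : ∀ p, (f p).2 = p.2)
    (hs : ContMDiff (𝓘(ℝ, V (l + 1)).prod (𝓡 k)) 𝓘(ℝ, V (l + 1)) ∞ F')
    (hF : ∀ v y, 2 ≤ ‖v‖ → F (v, y) = ‖v‖ • (φ.symm (f (dir v, y)).1 : V (l + 1)))
    (hl : ∀ v y, F' (F (v, y), y) = v) :
    ContMDiff (𝓡 (l + k + 1)) (𝓡 (l + k + 1)) ∞ (ofSphere f φ F') := by
  have : Fact (Module.finrank ℝ (V (l + k + 1 + 1)) = l + k + 1 + 1) := ⟨by simp⟩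
  have hq : ContMDiff (𝓡 (l + k + 1)) 𝓘(ℝ, V (l + 1) × V (k + 1)) ∞
      (fun p : S (l + k + 1) => (prodModel l k).symm (p : V (l + k + 1 + 1))) :=
    (prodModel l k).symm.contDiff.contMDiff.comp contMDiff_coe_sphere
  have hq1 : ContMDiff (𝓡 (l + k + 1)) 𝓘(ℝ, V (l + 1)) ∞
      (fun p : S (l + k + 1) => ((prodModel l k).symm (p : V (l + k + 1 + 1))).1) :=
    contDiff_fst.contMDiff.comp hq
  have hq2 : ContMDiff (𝓡 (l + k + 1)) 𝓘(ℝ, V (k + 1)) ∞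
      (fun p : S (l + k + 1) => ((prodModel l k).symm (p : V (l + k + 1 + 1))).2) :=
    contDiff_snd.contMDiff.comp hq
  have hinv {n : ℕ} {v : V n} (hv : v ≠ 0) : ContMDiffAt 𝓘(ℝ, V n) 𝓘(ℝ, ℝ) ∞
      (fun v : V n => ‖v‖⁻¹) v :=
    ((contDiffAt_norm ℝ hv).inv (norm_ne_zero_iff.2 hv)).contMDiffAt
  intro p
  by_cases hp : ((prodModel l k).symm (p : V (l + k + 1 + 1))).2 = 0
  · have hp1 : ((prodModel l k).symm (p : V (l + k + 1 + 1))).1 ≠ 0 := by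
      intro h
      have : (prodModel l k).symm (p : V (l + k + 1 + 1)) = 0 := Prod.ext h hp
      rw [map_eq_zero_iff _ (prodModel l k).symm.injective] at this
      exact coe_ne_zero p this
    have hd : ContMDiffAt (𝓡 (l + k + 1)) (𝓡 l) ∞
        (fun p : S (l + k + 1) => dir ((prodModel l k).symm (p : V (l + k + 1 + 1))).1) p :=
      ContMDiffAt.comp p ((contMDiffOn_dir l).contMDiffAt (isOpen_ne.mem_nhds hp1)) (hq1 p)
    have h1 : ContMDiffAt (𝓡 (l + k + 1)) ((𝓡 l).prod 𝓘(ℝ, V (k + 1))) ∞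
        (fun p : S (l + k + 1) => (φ (dir ((prodModel l k).symm (p : V (l + k + 1 + 1))).1),
          ‖((prodModel l k).symm (p : V (l + k + 1 + 1))).1‖⁻¹ •
            ((prodModel l k).symm (p : V (l + k + 1 + 1))).2)) p :=
      (φ.contMDiff.contMDiffAt.comp p hd).prodMk
        ((ContMDiffAt.comp p (hinv hp1) (hq1 p)).smul (hq2 p))
    refine ((Handles.contMDiff_inr f).contMDiffAt.comp p h1).congr_of_eventuallyEq ?_
    have ho : IsOpen {p : S (l + k + 1) | 2 * ‖((prodModel l k).symm (p : V (l + k + 1 + 1))).2‖ <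
        ‖((prodModel l k).symm (p : V (l + k + 1 + 1))).1‖} :=
      isOpen_lt (continuous_const.mul hq2.continuous.norm) hq1.continuous.norm
    filter_upwards [ho.mem_nhds (by simpa [hp] using hp1)] with r hr
    refine ofSphere_eq hf hF hl (fun h => ?_) (le_of_lt hr)
    have hr' : 2 * ‖((prodModel l k).symm (r : V (l + k + 1 + 1))).2‖ <
        ‖((prodModel l k).symm (r : V (l + k + 1 + 1))).1‖ := hr
    rw [h, norm_zero] at hr'
    linarith [norm_nonneg ((prodModel l k).symm (r : V (l + k + 1 + 1))).2]
  · have hd : ContMDiffAt (𝓡 (l + k + 1)) (𝓡 k) ∞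
        (fun p : S (l + k + 1) => dir ((prodModel l k).symm (p : V (l + k + 1 + 1))).2) p :=
      ContMDiffAt.comp p ((contMDiffOn_dir k).contMDiffAt (isOpen_ne.mem_nhds hp)) (hq2 p)
    have h1 : ContMDiffAt (𝓡 (l + k + 1)) (𝓘(ℝ, V (l + 1)).prod (𝓡 k)) ∞
        (fun p : S (l + k + 1) => (‖((prodModel l k).symm (p : V (l + k + 1 + 1))).2‖⁻¹ •
            ((prodModel l k).symm (p : V (l + k + 1 + 1))).1,
          dir ((prodModel l k).symm (p : V (l + k + 1 + 1))).2)) p :=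
      ((ContMDiffAt.comp p (hinv hp) (hq2 p)).smul (hq1 p)).prodMk hd
    have h2 := (Handles.contMDiff_inl f).contMDiffAt.comp p
      ((hs.contMDiffAt.comp p h1).prodMk hd)
    refine h2.congr_of_eventuallyEq ?_
    filter_upwards [(isOpen_ne.preimage hq2.continuous).mem_nhds hp] with r hr
    exact if_neg hr

/-- If the gluing map `f` fibres over `S^k` and `φ⁻¹ ∘ f`, radially extended, extends to a family
of diffeomorphisms of `ℝ^{l+1}`, then `Handles f` is the standard sphere. -/
theorem nonempty_diffeo_sphere (hf : ∀ p, (f p).2 = p.2)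
    (hs : ContMDiff (𝓘(ℝ, V (l + 1)).prod (𝓡 k)) 𝓘(ℝ, V (l + 1)) ∞ F)
    (hs' : ContMDiff (𝓘(ℝ, V (l + 1)).prod (𝓡 k)) 𝓘(ℝ, V (l + 1)) ∞ F')
    (hl : ∀ v y, F' (F (v, y), y) = v) (hr : ∀ v y, F (F' (v, y), y) = v)
    (hF : ∀ v y, 2 ≤ ‖v‖ → F (v, y) = ‖v‖ • (φ.symm (f (dir v, y)).1 : V (l + 1))) :
    Nonempty (Handles f ≃ₘ⟮𝓡 (l + k + 1), 𝓡 (l + k + 1)⟯ S (l + k + 1)) :=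
  ⟨{ toFun := toSphere f φ F
     invFun := ofSphere f φ F'
     left_inv := ofSphere_toSphere hl
     right_inv := toSphere_ofSphere hr
     contMDiff_toFun := contMDiff_toSphere hf hs hF
     contMDiff_invFun := contMDiff_ofSphere hf hs' hF hl }⟩

end Recognition

/-! ## Global inverses -/

/-- A proper local homeomorphism onto a connected space is bijective if some point has exactly one
preimage. -/
theorem bijective_of_isLocalHomeomorph_of_isProperMap {X Y : Type*} [TopologicalSpace X]
    [TopologicalSpace Y] [T2Space X] [T2Space Y] [PreconnectedSpace Y] {f : X → Y}
    (hf : IsLocalHomeomorph f) (hp : IsProperMap f) {x₀ : X} (hx₀ : ∀ x, f x = f x₀ → x = x₀) :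
    Function.Bijective f := by
  constructor
  -- `D` is the set of double points and `Y₂` its image. `Y₂` is closed by properness, open because
  -- both branches through a double point cover a neighbourhood of the value, and it misses `f x₀`;
  -- hence it is empty.
  · let D : Set (X × X) := {p | f p.1 = f p.2 ∧ p.1 ≠ p.2}
    let Y₂ : Set Y := {y | ∃ p ∈ D, f p.1 = y}
    have hD : IsClosed D := by
      refine isClosed_iff_frequently.2 fun p hp' => ?_
      have h1 : f p.1 = f p.2 := by
        refine (isClosed_eq (hf.continuous.comp continuous_fst)
          (hf.continuous.comp continuous_snd)).mem_of_frequently_of_tendsto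
          (hp'.mono fun q hq => hq.1) Filter.tendsto_id
      refine ⟨h1, fun h2 => ?_⟩
      obtain ⟨a, b⟩ := p
      obtain rfl : a = b := h2
      -- Local injectivity keeps double points away from the diagonal.
      obtain ⟨U, hU, haU, hinj⟩ := hf.isLocallyInjective a
      obtain ⟨q, ⟨hq1, hq2⟩, hq3⟩ := (hp'.and_eventually ((hU.prod hU).mem_nhds ⟨haU, haU⟩)).exists
      exact hq2 (hinj hq3.1 hq3.2 hq1)
    have hc : IsClosed Y₂ := by
      have h1 := (hp.prodMap hp).isClosedMap D hD
      have h2 : Y₂ = (fun y => (y, y)) ⁻¹' (Prod.map f f '' D) := by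
        ext y
        constructor
        · rintro ⟨p, hp, rfl⟩
          exact ⟨p, hp, Prod.ext rfl hp.1.symm⟩
        · rintro ⟨p, hp, h⟩
          exact ⟨p, hp, congrArg Prod.fst h⟩
      rw [h2]
      exact h1.preimage (by fun_prop)
    have ho : IsOpen Y₂ := by
      refine isOpen_iff_mem_nhds.2 ?_
      rintro _ ⟨⟨a, b⟩, ⟨h1, h2⟩, rfl⟩
      obtain ⟨U, W, hU, hW, haU, hbW, hd⟩ := t2_separation h2
      have hb := (hf.isOpenMap W hW).mem_nhds ⟨b, hbW, rfl⟩
      rw [← show f a = f b from h1] at hb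
      filter_upwards [(hf.isOpenMap U hU).mem_nhds ⟨a, haU, rfl⟩, hb]
      rintro y ⟨a', ha', rfl⟩ ⟨b', hb', h⟩
      exact ⟨(a', b'), ⟨h.symm, fun h' => Set.disjoint_left.1 hd ha' ((show a' = b' from h') ▸ hb')⟩, rfl⟩
    have he : Y₂ = ∅ := by
      refine (isClopen_iff.1 ⟨hc, ho⟩).resolve_right fun h => ?_
      obtain ⟨⟨a, b⟩, ⟨h1, h2⟩, h3⟩ : f x₀ ∈ Y₂ := h ▸ Set.mem_univ _
      exact h2 ((hx₀ a h3).trans (hx₀ b (h1.symm.trans h3)).symm)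
    intro a b hab
    by_contra hne
    exact (he ▸ (⟨(a, b), ⟨hab, hne⟩, rfl⟩ : f a ∈ Y₂) : f a ∈ (∅ : Set Y))
  · rw [← Set.range_eq_univ]
    exact IsClopen.eq_univ ⟨hp.isClosedMap.isClosed_range, hf.isOpenMap.isOpen_range⟩ ⟨_, x₀, rfl⟩

section Inverse

variable {W E : Type*} [NormedAddCommGroup W] [NormedSpace ℝ W] [NormedAddCommGroup E]
  [NormedSpace ℝ E]

theorem isLocalHomeomorph_of_isUnit_fderiv [CompleteSpace E] {f : E → E} (hf : ContDiff ℝ ∞ f)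
    (hu : ∀ v, IsUnit (fderiv ℝ f v)) : IsLocalHomeomorph f := by
  refine IsLocalHomeomorph.mk f fun v => ?_
  obtain ⟨u, hu⟩ := hu v
  have h : HasFDerivAt f ((ContinuousLinearEquiv.ofUnit u : E ≃L[ℝ] E) : E →L[ℝ] E) v := by
    have := (hf.differentiable (by simp) v).hasFDerivAt
    rw [← hu] at this
    exact this
  exact ⟨(hf.contDiffAt (x := v)).toOpenPartialHomeomorph f h (by simp),
    ContDiffAt.mem_toOpenPartialHomeomorph_source _ h (by simp), fun _ _ => rfl⟩

/-- The inverses of a smooth family of diffeomorphisms form a smooth family. -/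
theorem contDiffAt_family_inverse [CompleteSpace W] [CompleteSpace E] {f g : W × E → E} {O : Set W}
    (hO : IsOpen O) (hf : ∀ A ∈ O, ∀ v, ContDiffAt ℝ ∞ f (A, v))
    (hu : ∀ A ∈ O, ∀ v, IsUnit (fderiv ℝ (fun v => f (A, v)) v))
    (hgf : ∀ A ∈ O, ∀ v, g (A, f (A, v)) = v) {A : W} (hA : A ∈ O) (v : E) :
    ContDiffAt ℝ ∞ g (A, f (A, v)) := by
  obtain ⟨u, hu⟩ := hu A hA v
  have hfd : HasFDerivAt f (fderiv ℝ f (A, v)) (A, v) :=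
    ((hf A hA v).differentiableAt (by simp)).hasFDerivAt
  have h1 : (fderiv ℝ f (A, v)).comp (ContinuousLinearMap.inr ℝ W E) = u := by
    rw [hu]
    exact (hfd.comp v (hasFDerivAt_prodMk_right A v)).fderiv.symm
  -- The map `(A, v) ↦ (A, f (A, v))` has a block triangular derivative with invertible diagonal
  -- blocks. The inverse function theorem applies, and `g` is the second component of the local
  -- inverse.
  let T : (W × E) ≃L[ℝ] (W × E) := (ContinuousLinearEquiv.refl ℝ W).skewProd
    (ContinuousLinearEquiv.ofUnit u) ((fderiv ℝ f (A, v)).comp (ContinuousLinearMap.inl ℝ W E))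
  let Φ : W × E → W × E := fun p => (p.1, f p)
  have hΦ : ContDiffAt ℝ ∞ Φ (A, v) := contDiffAt_fst.prodMk (hf A hA v)
  have hT : HasFDerivAt Φ (T : W × E →L[ℝ] W × E) (A, v) := by
    refine (hasFDerivAt_fst.prodMk hfd).congr_fderiv ?_
    ext p
    · simp [T]
    · simp [T]
    · simp [T]
    · have := congrArg (fun L : E →L[ℝ] E => L p) h1
      change fderiv ℝ f (A, v) (0, p) = (u : E →L[ℝ] E) p + fderiv ℝ f (A, v) (0, 0)
      rw [show ((0 : W), (0 : E)) = 0 from rfl, map_zero, add_zero]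
      exact this
  have h2 := hΦ.to_localInverse hT (by simp)
  refine (contDiffAt_snd.comp (Φ (A, v)) h2).congr_of_eventuallyEq ?_
  have h3 : ∀ᶠ p in nhds (Φ (A, v)), Φ (hΦ.localInverse hT (by simp) p) = p :=
    (hΦ.hasStrictFDerivAt' hT (by simp)).eventually_right_inverse
  filter_upwards [h3, (hO.preimage continuous_fst).mem_nhds (show Φ (A, v) ∈ _ from hA)]
    with p hp hpO
  set q := hΦ.localInverse hT (by simp) p
  have hp' : (q.1, f q) = p := hp
  have hq1 : q.1 = p.1 := (Prod.ext_iff.1 hp').1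
  have hq2 : f q = p.2 := (Prod.ext_iff.1 hp').2
  have hqO : q.1 ∈ O := hq1 ▸ hpO
  have := hgf q.1 hqO q.2
  rw [show f (q.1, q.2) = p.2 from hq2, hq1] at this
  exact this

theorem isUnit_of_injective [FiniteDimensional ℝ E] {T : E →L[ℝ] E} (h : ∀ v, T v = 0 → v = 0) :
    IsUnit T := by
  have : CompleteSpace E := FiniteDimensional.complete ℝ E
  have hi : Function.Injective T := (injective_iff_map_eq_zero T).2 h
  exact ContinuousLinearMap.isUnit_iff_bijective.2
    ⟨hi, LinearMap.injective_iff_surjective (f := (T : E →ₗ[ℝ] E)).1 hi⟩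

/-- The chain rule gives the derivative a left inverse, and in finite dimension injectivity is
enough. -/
theorem isUnit_fderiv_of_leftInverse [FiniteDimensional ℝ E] {f g : E → E} {v : E}
    (hf : DifferentiableAt ℝ f v) (hg : DifferentiableAt ℝ g (f v))
    (h : ∀ᶠ w in nhds v, g (f w) = w) : IsUnit (fderiv ℝ f v) := by
  refine isUnit_of_injective fun w hw => ?_
  have h1 := (hg.hasFDerivAt.comp v hf.hasFDerivAt).congr_of_eventuallyEq
    (show id =ᶠ[nhds v] g ∘ f from h.mono fun w hw => hw.symm)
  have h2 := congrArg (fun L : E →L[ℝ] E => L w) ((hasFDerivAt_id v).unique h1)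
  simpa [hw] using h2

end Inverse

/-! ## Radial extensions -/

section Radial

variable {l : ℕ}

/-- The radial extension of a self-map of the sphere. -/
def radial (ψ : S l → S l) (v : V (l + 1)) : V (l + 1) := ‖v‖ • (ψ (dir v) : V (l + 1))

theorem norm_radial (ψ : S l → S l) (v : V (l + 1)) : ‖radial ψ v‖ = ‖v‖ :=
  norm_smul_coe (norm_nonneg v) _

theorem dir_radial (ψ : S l → S l) {v : V (l + 1)} (hv : v ≠ 0) : dir (radial ψ v) = ψ (dir v) :=
  dir_smul (norm_pos_iff.2 hv) _

theorem radial_radial (ψ χ : S l → S l) (v : V (l + 1)) :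
    radial ψ (radial χ v) = radial (ψ ∘ χ) v := by
  by_cases hv : v = 0
  · simp [hv, radial]
  · rw [radial, norm_radial, dir_radial _ hv]; rfl

theorem radial_id (v : V (l + 1)) : radial id v = v := norm_smul_dir v

theorem radial_coe (ψ : S l → S l) (x : S l) : radial ψ (x : V (l + 1)) = ψ x := by
  simp [radial, dir_coe]

theorem contDiffAt_radial {ψ : S l → S l} (hψ : ContMDiff (𝓡 l) (𝓡 l) ∞ ψ) {v : V (l + 1)}
    (hv : v ≠ 0) : ContDiffAt ℝ ∞ (radial ψ) v := by
  have : Fact (Module.finrank ℝ (V (l + 1)) = l + 1) := ⟨by simp⟩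
  have h1 : ContMDiffAt 𝓘(ℝ, V (l + 1)) 𝓘(ℝ, V (l + 1)) ∞
      (fun v : V (l + 1) => (ψ (dir v) : V (l + 1))) v :=
    (contMDiff_coe_sphere.comp hψ).contMDiffAt.comp v
      ((contMDiffOn_dir l).contMDiffAt (isOpen_ne.mem_nhds hv))
  exact (contDiffAt_norm ℝ hv).smul h1.contDiffAt

theorem isUnit_fderiv_radial (ψ : SphereDiffeo l) {v : V (l + 1)} (hv : v ≠ 0) :
    IsUnit (fderiv ℝ (radial ψ) v) := by
  have hv' : radial ψ v ≠ 0 := by rwa [← norm_ne_zero_iff, norm_radial, norm_ne_zero_iff]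
  refine isUnit_fderiv_of_leftInverse ((contDiffAt_radial ψ.contMDiff hv).differentiableAt (by simp))
    ((contDiffAt_radial ψ.symm.contMDiff hv').differentiableAt (by simp)) (.of_forall fun w => ?_)
  rw [radial_radial]
  convert radial_id w using 2
  ext1 x
  simp

/-- The map preserves norms outside the disc, hence is proper. A point whose norm exceeds all norms
attained on the image of the disc has its preimages outside the disc, where the map is injective; so
it has exactly one. -/
theorem bijective_of_eq_radial {f : V (l + 1) → V (l + 1)} (hf : IsLocalHomeomorph f)
    (ψ : SphereDiffeo l) (hrad : ∀ v, 1 ≤ ‖v‖ → f v = radial ψ v) : Function.Bijective f := by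
  have hp : IsProperMap f := by
    rw [isProperMap_iff_tendsto_cocompact]
    refine ⟨hf.continuous, ?_⟩
    rw [← Metric.cobounded_eq_cocompact, ← tendsto_norm_atTop_iff_cobounded]
    refine (tendsto_norm_cobounded_atTop (E := V (l + 1))).congr' ?_
    filter_upwards [(tendsto_norm_cobounded_atTop (E := V (l + 1))).eventually_ge_atTop 1]
      with v hv
    rw [hrad v hv, norm_radial]
  obtain ⟨R, hR⟩ := ((isCompact_closedBall (0 : V (l + 1)) 1).image hf.continuous).isBounded
    |>.exists_norm_le
  have hR0 : 0 < max R 1 + 1 := by positivity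
  have hR1 : 1 ≤ max R 1 + 1 := by linarith [le_max_right R 1]
  refine bijective_of_isLocalHomeomorph_of_isProperMap hf hp
    (x₀ := (max R 1 + 1) • (pole l : V (l + 1))) fun x hx => ?_
  have hn : ‖(max R 1 + 1) • (pole l : V (l + 1))‖ = max R 1 + 1 := norm_smul_coe hR0.le _
  rw [hrad ((max R 1 + 1) • (pole l : V (l + 1))) (by rw [hn]; exact hR1)] at hx
  have hfx : ‖f x‖ = max R 1 + 1 := by rw [hx, norm_radial, hn]
  have hx1 : 1 ≤ ‖x‖ := by
    by_contra! h
    have := hR _ ⟨x, mem_closedBall_zero_iff.2 h.le, rfl⟩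
    linarith [le_max_left R 1]
  rw [hrad x hx1] at hx
  have := congrArg (radial ψ.symm) hx
  rw [radial_radial, radial_radial] at this
  have hid : (ψ.symm : S l → S l) ∘ ψ = id := by ext1 x; simp
  simpa only [hid, radial_id] using this

/-- A smooth family of local diffeomorphisms of `ℝ^{l+1}` that are radial outside the unit disc
has a smooth family of inverses. -/
theorem exists_family_inverse {W : Type*} [NormedAddCommGroup W] [NormedSpace ℝ W]
    [CompleteSpace W] {f : W × V (l + 1) → V (l + 1)} {O : Set W} (hO : IsOpen O)
    (hf : ∀ A ∈ O, ∀ v, ContDiffAt ℝ ∞ f (A, v))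
    (hu : ∀ A ∈ O, ∀ v, IsUnit (fderiv ℝ (fun v => f (A, v)) v))
    (hrad : ∀ A ∈ O, ∃ ψ : SphereDiffeo l, ∀ v, 1 ≤ ‖v‖ → f (A, v) = radial ψ v) :
    ∃ g : W × V (l + 1) → V (l + 1), (∀ A ∈ O, ∀ v, ContDiffAt ℝ ∞ g (A, v)) ∧
      (∀ A ∈ O, ∀ v, g (A, f (A, v)) = v) ∧ ∀ A ∈ O, ∀ v, f (A, g (A, v)) = v := by
  have hb (A : W) (hA : A ∈ O) : Function.Bijective fun v => f (A, v) := by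
    obtain ⟨ψ, hψ⟩ := hrad A hA
    refine bijective_of_eq_radial (isLocalHomeomorph_of_isUnit_fderiv ?_ (hu A hA)) ψ hψ
    exact contDiff_iff_contDiffAt.2 fun v =>
      (hf A hA v).comp v (contDiffAt_const.prodMk contDiffAt_id)
  let g : W × V (l + 1) → V (l + 1) := fun p => Function.invFun (fun v => f (p.1, v)) p.2
  have hl (A : W) (hA : A ∈ O) (v : V (l + 1)) : g (A, f (A, v)) = v :=
    Function.leftInverse_invFun (hb A hA).1 v
  have hr (A : W) (hA : A ∈ O) (v : V (l + 1)) : f (A, g (A, v)) = v :=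
    Function.rightInverse_invFun (hb A hA).2 v
  refine ⟨g, fun A hA v => ?_, hl, hr⟩
  have := contDiffAt_family_inverse hO hf hu hl hA (g (A, v))
  rwa [hr A hA] at this

end Radial

/-! ## Linear maps acting on directions, and families of extensions to the disc -/

section LinearAction

variable {l : ℕ}

theorem apply_ne_zero_of_isUnit {E : Type*} [NormedAddCommGroup E] [NormedSpace ℝ E]
    {A : E →L[ℝ] E} (hA : IsUnit A) {v : E} (hv : v ≠ 0) : A v ≠ 0 := by
  obtain ⟨u, rfl⟩ := hA
  intro h
  apply hv
  have : (↑u⁻¹ : E →L[ℝ] E) ((u : E →L[ℝ] E) v) = v :=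
    congrArg (fun L : E →L[ℝ] E => L v) u.inv_mul
  rw [h, map_zero] at this
  exact this.symm

/-- The action of linear maps on directions. -/
def lin (A : V (l + 1) →L[ℝ] V (l + 1)) (x : S l) : S l := dir (A x)

/-- Normalizing `B x` introduces a positive factor, which does not affect directions. Invertibility
of `B` keeps `B x` away from the origin, where `dir` has only a default value. -/
theorem lin_lin (A : V (l + 1) →L[ℝ] V (l + 1)) {B : V (l + 1) →L[ℝ] V (l + 1)} (hB : IsUnit B)
    (x : S l) : lin A (lin B x) = lin (A * B) x := by
  have h := apply_ne_zero_of_isUnit hB (coe_ne_zero x)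
  rw [lin, lin, coe_dir h, map_smul, dir_smul_of_pos (inv_pos.2 (norm_pos_iff.2 h))]
  rfl

theorem lin_one (x : S l) : lin 1 x = x := dir_coe x

section Smooth

variable {E H M : Type*} [NormedAddCommGroup E] [NormedSpace ℝ E] [TopologicalSpace H]
  {I : ModelWithCorners ℝ E H} [TopologicalSpace M] [ChartedSpace H M]

theorem contMDiffAt_lin {A : M → V (l + 1) →L[ℝ] V (l + 1)} {x : M → S l} {p : M}
    (hA : ContMDiffAt I 𝓘(ℝ, V (l + 1) →L[ℝ] V (l + 1)) ∞ A p) (hx : ContMDiffAt I (𝓡 l) ∞ x p)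
    (hu : IsUnit (A p)) : ContMDiffAt I (𝓡 l) ∞ (fun p => lin (A p) (x p)) p := by
  have : Fact (Module.finrank ℝ (V (l + 1)) = l + 1) := ⟨by simp⟩
  have h1 : ContMDiffAt I 𝓘(ℝ, V (l + 1)) ∞ (fun p => A p (x p : V (l + 1))) p :=
    hA.clm_apply (contMDiff_coe_sphere.contMDiffAt.comp p hx)
  exact ContMDiffAt.comp p ((contMDiffOn_dir l).contMDiffAt
    (isOpen_ne.mem_nhds (apply_ne_zero_of_isUnit hu (coe_ne_zero (x p))))) h1

end Smooth

/-- The diffeomorphism of the sphere induced by an invertible linear map. -/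
def linDiffeo (A : V (l + 1) →L[ℝ] V (l + 1)) (hA : IsUnit A) : SphereDiffeo l where
  toFun := lin A
  invFun := lin (Ring.inverse A)
  left_inv x := by rw [lin_lin _ hA, Ring.inverse_mul_cancel _ hA, lin_one]
  right_inv x := by rw [lin_lin _ hA.ringInverse, Ring.mul_inverse_cancel _ hA, lin_one]
  contMDiff_toFun _ := contMDiffAt_lin contMDiffAt_const contMDiffAt_id hA
  contMDiff_invFun _ := contMDiffAt_lin contMDiffAt_const contMDiffAt_id hA.ringInverse

/-- The action of linear maps on directions, conjugated by a diffeomorphism. -/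
def conj (φ : SphereDiffeo l) (A : V (l + 1) →L[ℝ] V (l + 1)) : S l → S l := φ.symm ∘ lin A ∘ φ

def conjDiffeo (φ : SphereDiffeo l) (A : V (l + 1) →L[ℝ] V (l + 1)) (hA : IsUnit A) :
    SphereDiffeo l :=
  (φ.trans (linDiffeo A hA)).trans φ.symm

theorem conj_comp_conj (φ : SphereDiffeo l) (A : V (l + 1) →L[ℝ] V (l + 1))
    {B : V (l + 1) →L[ℝ] V (l + 1)} (hB : IsUnit B) :
    conj φ A ∘ conj φ B = conj φ (A * B) := by
  ext1 x
  simp [conj, lin_lin A hB]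

theorem conj_one (φ : SphereDiffeo l) : conj φ 1 = id := by
  ext1 x
  simp [conj, lin_one]

section Smooth

variable {E H M : Type*} [NormedAddCommGroup E] [NormedSpace ℝ E] [TopologicalSpace H]
  {I : ModelWithCorners ℝ E H} [TopologicalSpace M] [ChartedSpace H M]

theorem contMDiffAt_radial_conj (φ : SphereDiffeo l) {A : M → V (l + 1) →L[ℝ] V (l + 1)}
    {v : M → V (l + 1)} {p : M} (hA : ContMDiffAt I 𝓘(ℝ, V (l + 1) →L[ℝ] V (l + 1)) ∞ A p)
    (hv : ContMDiffAt I 𝓘(ℝ, V (l + 1)) ∞ v p) (hu : IsUnit (A p)) (h0 : v p ≠ 0) :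
    ContMDiffAt I 𝓘(ℝ, V (l + 1)) ∞ (fun p => radial (conj φ (A p)) (v p)) p := by
  have : Fact (Module.finrank ℝ (V (l + 1)) = l + 1) := ⟨by simp⟩
  have h1 : ContMDiffAt I (𝓡 l) ∞ (fun p => dir (v p)) p :=
    ContMDiffAt.comp p ((contMDiffOn_dir l).contMDiffAt (isOpen_ne.mem_nhds h0)) hv
  have h2 : ContMDiffAt I (𝓡 l) ∞ (fun p => conj φ (A p) (dir (v p))) p :=
    φ.symm.contMDiff.contMDiffAt.comp p
      (contMDiffAt_lin hA (φ.contMDiff.contMDiffAt.comp p h1) hu)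
  exact (ContMDiffAt.comp p (contDiffAt_norm ℝ h0).contMDiffAt hv).smul
    (contMDiff_coe_sphere.contMDiffAt.comp p h2)

end Smooth

/-- Interpolation between a linear map `A` near the origin and the radial extension of
`φ⁻¹ ∘ A ∘ φ` outside the unit disc. -/
def interp (φ : SphereDiffeo l) (p : (V (l + 1) →L[ℝ] V (l + 1)) × V (l + 1)) : V (l + 1) :=
  p.1 p.2 + Real.smoothTransition (4 * ‖p.2‖ - 2) • (radial (conj φ p.1) p.2 - p.1 p.2)

theorem interp_eq_radial (φ : SphereDiffeo l) (A : V (l + 1) →L[ℝ] V (l + 1)) {v : V (l + 1)}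
    (hv : 3 / 4 ≤ ‖v‖) : interp φ (A, v) = radial (conj φ A) v := by
  rw [interp, Real.smoothTransition.one_of_one_le (by dsimp only; linarith), one_smul]
  abel

/-- The cutoff vanishes for `‖v‖ ≤ 1/2`, so the map is linear near the origin and the possible
singularity of the radial extension there is not seen. -/
theorem contDiffAt_interp (φ : SphereDiffeo l) {A : V (l + 1) →L[ℝ] V (l + 1)} (hA : IsUnit A)
    (v : V (l + 1)) : ContDiffAt ℝ ∞ (interp φ) (A, v) := by
  have h1 : ContDiff ℝ ∞ fun p : (V (l + 1) →L[ℝ] V (l + 1)) × V (l + 1) => p.1 p.2 :=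
    contDiff_fst.clm_apply contDiff_snd
  by_cases hv : v = 0
  · refine h1.contDiffAt.congr_of_eventuallyEq ?_
    have ho : IsOpen {p : (V (l + 1) →L[ℝ] V (l + 1)) × V (l + 1) | ‖p.2‖ < 1 / 2} :=
      isOpen_lt continuous_snd.norm continuous_const
    filter_upwards [ho.mem_nhds (by simp [hv])] with p hp
    have hp' : ‖p.2‖ < 1 / 2 := hp
    rw [interp, Real.smoothTransition.zero_of_nonpos (by linarith), zero_smul, add_zero]
  · have h2 : ContDiffAt ℝ ∞ (fun p : (V (l + 1) →L[ℝ] V (l + 1)) × V (l + 1) =>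
        radial (conj φ p.1) p.2) (A, v) :=
      (contMDiffAt_radial_conj (I := 𝓘(ℝ, (V (l + 1) →L[ℝ] V (l + 1)) × V (l + 1))) φ
        contDiff_fst.contMDiff.contMDiffAt contDiff_snd.contMDiff.contMDiffAt hA hv).contDiffAt
    have h3 : ContDiffAt ℝ ∞ (fun p : (V (l + 1) →L[ℝ] V (l + 1)) × V (l + 1) =>
        Real.smoothTransition (4 * ‖p.2‖ - 2)) (A, v) :=
      Real.smoothTransition.contDiff.contDiffAt.comp _
        ((contDiffAt_const.mul ((contDiffAt_norm ℝ hv).comp (A, v) contDiffAt_snd)).sub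
          contDiffAt_const)
    exact h1.contDiffAt.add (h3.smul (h2.sub h1.contDiffAt))

/-- For `A` in a neighbourhood of a compact set of linear maps commuting with `φ`, the
diffeomorphisms `φ⁻¹ ∘ A ∘ φ` of the sphere extend to a smooth family of diffeomorphisms of
`ℝ^{l+1}`. -/
theorem exists_extension_near_commuting (φ : SphereDiffeo l)
    {K : Set (V (l + 1) →L[ℝ] V (l + 1))} (hK : IsCompact K) (hu : ∀ A ∈ K, IsUnit A)
    (hc : ∀ A ∈ K, ∀ v, radial (conj φ A) v = A v) :
    ∃ O : Set (V (l + 1) →L[ℝ] V (l + 1)), IsOpen O ∧ K ⊆ O ∧ (∀ A ∈ O, IsUnit A) ∧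
      ∃ E E' : (V (l + 1) →L[ℝ] V (l + 1)) × V (l + 1) → V (l + 1),
        (∀ A ∈ O, ∀ v, ContDiffAt ℝ ∞ E (A, v)) ∧ (∀ A ∈ O, ∀ v, ContDiffAt ℝ ∞ E' (A, v)) ∧
        (∀ A ∈ O, ∀ v, E' (A, E (A, v)) = v) ∧ (∀ A ∈ O, ∀ v, E (A, E' (A, v)) = v) ∧
        ∀ A ∈ O, ∀ v, 1 ≤ ‖v‖ → E (A, v) = radial (conj φ A) v := by
  let U : Set ((V (l + 1) →L[ℝ] V (l + 1)) × V (l + 1)) := {p | IsUnit p.1}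
  have hU : IsOpen U := Units.isOpen.preimage continuous_fst
  have hfd (p) (hp : p ∈ U) : fderiv ℝ (fun v => interp φ (p.1, v)) p.2 =
      (fderiv ℝ (interp φ) p).comp (ContinuousLinearMap.inr ℝ _ _) :=
    ((((contDiffAt_interp φ hp p.2).differentiableAt (by simp)).hasFDerivAt).comp p.2
      (hasFDerivAt_prodMk_right p.1 p.2)).fderiv
  have hcont : ContinuousOn (fun p : (V (l + 1) →L[ℝ] V (l + 1)) × V (l + 1) =>
      fderiv ℝ (fun v => interp φ (p.1, v)) p.2) U := by
    refine ContinuousOn.congr (f := fun p => (fderiv ℝ (interp φ) p).comp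
      (ContinuousLinearMap.inr ℝ _ _)) (fun p hp => ?_) hfd
    have h1 : ContinuousAt (fderiv ℝ (interp φ)) p :=
      ((contDiffAt_interp φ hp p.2).fderiv_right (m := 0) (by simp)).continuousAt
    exact (h1.clm_comp continuousAt_const).continuousWithinAt
  -- Invertibility of the derivative in `v` is an open condition on `(A, v)`. For `A ∈ K` the two
  -- interpolated maps coincide, so the map is `A` itself and the condition holds on `K` times the
  -- disc; the tube lemma then gives `O`.
  have hN := hcont.isOpen_inter_preimage hU (Units.isOpen (R := V (l + 1) →L[ℝ] V (l + 1)))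
  obtain ⟨O, B, hO, hB, hKO, hBB, hOB⟩ := generalized_tube_lemma hK
    (isCompact_closedBall (0 : V (l + 1)) 1) hN (by
      rintro ⟨A, v⟩ ⟨hA, -⟩
      refine ⟨hu A hA, ?_⟩
      change IsUnit (fderiv ℝ (fun v => interp φ (A, v)) v)
      have : (fun v => interp φ (A, v)) = A := by
        ext1 v
        simp [interp, hc A hA]
      rw [this, ContinuousLinearMap.fderiv]
      exact hu A hA)
  have hOu (A) (hA : A ∈ O) : IsUnit A :=
    (hOB (show (A, (0 : V (l + 1))) ∈ O ×ˢ B from ⟨hA, hBB (by simp)⟩)).1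
  have hrad (A : V (l + 1) →L[ℝ] V (l + 1)) (v : V (l + 1)) (hv : 1 ≤ ‖v‖) :
      interp φ (A, v) = radial (conj φ A) v := interp_eq_radial φ A (by linarith)
  obtain ⟨E', h1, h2, h3⟩ := exists_family_inverse (f := interp φ) hO
    (fun A hA v => contDiffAt_interp φ (hOu A hA) v) (fun A hA v => by
      -- In the disc invertibility comes from the tube; outside it the map is locally the radial
      -- extension of a diffeomorphism.
      by_cases hv : ‖v‖ ≤ 1
      · exact (hOB (show (A, v) ∈ O ×ˢ B from ⟨hA, hBB (by simpa using hv)⟩)).2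
      · push Not at hv
        have h0 : v ≠ 0 := norm_pos_iff.1 (by linarith)
        have : (fun v => interp φ (A, v)) =ᶠ[nhds v] radial (conjDiffeo φ A (hOu A hA)) := by
          filter_upwards [(isOpen_lt continuous_const continuous_norm).mem_nhds
            (show (1 : ℝ) < ‖v‖ from hv)] with w hw
          exact hrad A w (le_of_lt hw)
        rw [this.fderiv_eq]
        exact isUnit_fderiv_radial _ h0)
    (fun A hA => ⟨conjDiffeo φ A (hOu A hA), fun v hv => hrad A v hv⟩)
  exact ⟨O, hO, hKO, hOu, interp φ, E', fun A hA v => contDiffAt_interp φ (hOu A hA) v, h1, h2, h3,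
    fun A _ v hv => hrad A v hv⟩

/-! ### Twisting along concentric spheres -/

section Twisting

variable {k : ℕ} (φ : SphereDiffeo l) {Q Q' : ℝ × S k → V (l + 1) →L[ℝ] V (l + 1)}

/-- The self-map of `ℝ^{l+1}`, depending on `y ∈ S^k`, that acts on the sphere of radius `r` by
`φ⁻¹ ∘ Q (r, y) ∘ φ`. -/
def levelTwist (Q : ℝ × S k → V (l + 1) →L[ℝ] V (l + 1)) (p : V (l + 1) × S k) : V (l + 1) :=
  radial (conj φ (Q (‖p.1‖, p.2))) p.1

/-- By `h1` the map is the projection to `v` near the origin, the only place where a radial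
extension can fail to be smooth. -/
theorem contMDiff_levelTwist
    (hQ : ContMDiff (𝓘(ℝ, ℝ).prod (𝓡 k)) 𝓘(ℝ, V (l + 1) →L[ℝ] V (l + 1)) ∞ Q)
    (hu : ∀ p, IsUnit (Q p)) (h1 : ∀ r y, r ≤ 1 → Q (r, y) = 1) :
    ContMDiff (𝓘(ℝ, V (l + 1)).prod (𝓡 k)) 𝓘(ℝ, V (l + 1)) ∞ (levelTwist φ Q) := by
  intro p
  by_cases hp : p.1 = 0
  · refine (contMDiffAt_fst (I := 𝓘(ℝ, V (l + 1))) (J := 𝓡 k)).congr_of_eventuallyEq ?_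
    have ho : IsOpen {p : V (l + 1) × S k | ‖p.1‖ < 1} :=
      isOpen_lt continuous_fst.norm continuous_const
    filter_upwards [ho.mem_nhds (by simp [hp])] with q hq
    rw [levelTwist, h1 _ _ (le_of_lt hq), conj_one, radial_id]
  · refine contMDiffAt_radial_conj φ (hQ.contMDiffAt.comp p (ContMDiffAt.prodMk ?_ contMDiffAt_snd))
      contMDiffAt_fst (hu _) hp
    exact ContMDiffAt.comp p (contDiffAt_norm ℝ hp).contMDiffAt contMDiffAt_fst

/-- Radial maps preserve norms, so both twists use the same level and their linear maps multiply. -/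
theorem levelTwist_levelTwist (hu : ∀ p, IsUnit (Q p)) (h : ∀ p, Q' p * Q p = 1) (v : V (l + 1))
    (y : S k) : levelTwist φ Q' (levelTwist φ Q (v, y), y) = v := by
  simp only [levelTwist, norm_radial, radial_radial, conj_comp_conj φ _ (hu _), h, conj_one,
    radial_id]

end Twisting

end LinearAction

/-! ## Straightening a diffeomorphism of the disc near the boundary -/

/-- A cutoff function that is `1` up to `1 - δ`, vanishes near `1`, and has a small logarithmic
derivative with respect to the distance to `1`. -/
theorem exists_log_cutoff {δ κ : ℝ} (hδ : 0 < δ) (hκ : 0 < κ) :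
    ∃ χ : ℝ → ℝ, ContDiff ℝ ∞ χ ∧ (∀ r ≤ 1 - δ, χ r = 1) ∧
      (∃ δ' > 0, ∀ r, 1 - δ' ≤ r → χ r = 0) ∧ (∀ r, χ r ∈ Set.Icc 0 1) ∧
      ∀ r < 1, |deriv χ r| * (1 - r) ≤ κ := by
  have hθ : ContDiff ℝ ∞ Real.smoothTransition := Real.smoothTransition.contDiff
  obtain ⟨C, hC⟩ := (isCompact_Icc (a := (0 : ℝ)) (b := 1)).exists_bound_of_continuousOn
    ((hθ.continuous_deriv (by simp)).continuousOn)
  have hC' (x : ℝ) : |deriv Real.smoothTransition x| ≤ max C 1 := by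
    by_cases h0 : x < 0
    · have : Real.smoothTransition =ᶠ[nhds x] fun _ => 0 := by
        filter_upwards [Iio_mem_nhds h0] with y hy
        exact Real.smoothTransition.zero_of_nonpos (le_of_lt hy)
      rw [this.deriv_eq]; simp
    by_cases h1 : 1 < x
    · have : Real.smoothTransition =ᶠ[nhds x] fun _ => 1 := by
        filter_upwards [Ioi_mem_nhds h1] with y hy
        exact Real.smoothTransition.one_of_one_le (le_of_lt hy)
      rw [this.deriv_eq]; simp
    exact (hC x ⟨not_lt.1 h0, not_lt.1 h1⟩).trans (le_max_left _ _)
  have hCpos : 0 < max C 1 := lt_max_of_lt_right one_pos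
  set c := κ / max C 1 with hc
  have hcpos : 0 < c := div_pos hκ hCpos
  -- The derivative of `log (1 - r)` is `-1 / (1 - r)`, so `|χ'| (1 - r)` is at most `c` times a
  -- bound for the derivative of the transition function; `c` is chosen to make this `κ`.
  let χ : ℝ → ℝ := fun r =>
    if r < 1 then Real.smoothTransition (1 + c * Real.log ((1 - r) / δ)) else 0
  -- At distance `δ'` from 1 the argument of the transition function is exactly 0.
  set δ' := δ * Real.exp (-(1 / c)) with hδ'
  have hδ'pos : 0 < δ' := by positivity
  have hzero (r : ℝ) (hr : 1 - δ' ≤ r) : χ r = 0 := by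
    by_cases h : r < 1
    · simp only [χ, h, if_true]
      apply Real.smoothTransition.zero_of_nonpos
      have h1 : Real.log ((1 - r) / δ) ≤ -(1 / c) := by
        rw [Real.log_le_iff_le_exp (div_pos (by linarith) hδ), div_le_iff₀ hδ, mul_comm]
        linarith
      have h2 := mul_le_mul_of_nonneg_left h1 hcpos.le
      have h3 : c * -(1 / c) = -1 := by field_simp
      linarith
    · simp [χ, h]
  have hformula (r : ℝ) (hr : r < 1) :
      χ =ᶠ[nhds r] fun r => Real.smoothTransition (1 + c * Real.log ((1 - r) / δ)) := by
    filter_upwards [Iio_mem_nhds hr] with s hs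
    exact if_pos hs
  refine ⟨χ, ?_, ?_, ⟨δ', hδ'pos, hzero⟩, ?_, ?_⟩
  · refine contDiff_iff_contDiffAt.2 fun r => ?_
    by_cases hr : r < 1
    · refine ContDiffAt.congr_of_eventuallyEq ?_ (hformula r hr)
      have h1 : ContDiffAt ℝ ∞ (fun r : ℝ => (1 - r) / δ) r := by fun_prop
      exact hθ.contDiffAt.comp r (contDiffAt_const.add (contDiffAt_const.mul
        (h1.log (div_pos (by linarith) hδ).ne')))
    · refine (contDiffAt_const (c := (0 : ℝ))).congr_of_eventuallyEq ?_
      filter_upwards [Ioi_mem_nhds (show 1 - δ' < r by linarith)] with s hs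
      exact hzero s (le_of_lt hs)
  · intro r hr
    have h1 : r < 1 := by linarith
    simp only [χ, h1, if_true]
    apply Real.smoothTransition.one_of_one_le
    have : 0 ≤ Real.log ((1 - r) / δ) := Real.log_nonneg ((one_le_div hδ).2 (by linarith))
    nlinarith
  · intro r
    by_cases h : r < 1
    · simp only [χ, h, if_true]
      exact ⟨Real.smoothTransition.nonneg _, Real.smoothTransition.le_one _⟩
    · simp [χ, h]
  · intro r hr
    have hr' : 0 < 1 - r := by linarith
    have h1 : HasDerivAt (fun r : ℝ => (1 - r) / δ) (-1 / δ) r :=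
      ((hasDerivAt_id r).const_sub 1).div_const δ
    have h2 := ((h1.log (div_pos hr' hδ).ne').const_mul c).const_add 1
    have h3 := ((hθ.differentiable (by simp) _).hasDerivAt.comp r h2).congr_of_eventuallyEq
      (hformula r hr)
    rw [h3.deriv, abs_mul]
    have h4 : |c * (-1 / δ / ((1 - r) / δ))| * (1 - r) = c := by
      rw [show c * (-1 / δ / ((1 - r) / δ)) = -(c / (1 - r)) by field_simp, abs_neg,
        abs_of_pos (div_pos hcpos hr')]
      field_simp
    rw [mul_assoc, h4]
    calc _ ≤ max C 1 * c := mul_le_mul_of_nonneg_right (hC' _) hcpos.le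
      _ = κ := by rw [hc]; field_simp

/-! ### Derivatives at the boundary of the disc and the correction in a collar -/

section Collar

variable {l : ℕ} {ψ : SphereDiffeo l}

theorem hasFDerivAt_radial (ψ : SphereDiffeo l) {v : V (l + 1)} (hv : v ≠ 0) :
    HasFDerivAt (radial ψ) (fderiv ℝ (radial ψ) v) v :=
  ((contDiffAt_radial ψ.contMDiff hv).differentiableAt (by simp)).hasFDerivAt

/-- Differentiate `‖radial ψ v‖ ^ 2 = ‖v‖ ^ 2`. -/
theorem inner_fderiv_radial (ψ : SphereDiffeo l) (x : S l) (u : V (l + 1)) :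
    inner ℝ (ψ x : V (l + 1)) (fderiv ℝ (radial ψ) x u) = inner ℝ (x : V (l + 1)) u := by
  have h1 := (hasFDerivAt_radial ψ (coe_ne_zero x)).norm_sq
  have h2 := (hasFDerivAt_id (𝕜 := ℝ) (x : V (l + 1))).norm_sq
  have h3 : (fun v => ‖radial ψ v‖ ^ 2) = fun v => ‖id v‖ ^ 2 := by
    ext1 v; rw [norm_radial, id]
  rw [h3] at h1
  have h4 := congrArg (fun L : V (l + 1) →L[ℝ] ℝ => L u) (h1.unique h2)
  simpa [radial_coe] using h4

/-- Euler's identity: differentiate along the ray through `x`, on which the radial extension is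
linear. -/
theorem fderiv_radial_self (ψ : SphereDiffeo l) (x : S l) :
    fderiv ℝ (radial ψ) (x : V (l + 1)) x = ψ x := by
  have h1 : HasDerivAt (fun t : ℝ => t • (x : V (l + 1))) ((1 : ℝ) • (x : V (l + 1))) 1 :=
    (hasDerivAt_id (1 : ℝ)).smul_const _
  have h2 : HasFDerivAt (radial ψ) (fderiv ℝ (radial ψ) (x : V (l + 1)))
      ((1 : ℝ) • (x : V (l + 1))) := by
    rw [one_smul]; exact hasFDerivAt_radial ψ (coe_ne_zero x)
  have h3 := h2.comp_hasDerivAt 1 h1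
  have h4 : HasDerivAt (fun t : ℝ => t • (ψ x : V (l + 1))) ((1 : ℝ) • (ψ x : V (l + 1))) 1 :=
    (hasDerivAt_id (1 : ℝ)).smul_const _
  have h5 : (radial ψ ∘ fun t : ℝ => t • (x : V (l + 1))) =ᶠ[nhds 1]
      fun t : ℝ => t • (ψ x : V (l + 1)) := by
    filter_upwards [Ioi_mem_nhds (zero_lt_one (α := ℝ))] with t ht
    simp only [Function.comp_apply, radial]
    rw [norm_smul_coe (le_of_lt ht), dir_smul ht]
  simpa using (h3.unique (h4.congr_of_eventuallyEq h5))

variable {Ψ Ψ' : V (l + 1) → V (l + 1)}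

theorem uniqueDiffOn_disc : UniqueDiffOn ℝ (Metric.closedBall (0 : V (l + 1)) 1) :=
  uniqueDiffOn_convex (convex_closedBall _ _)
    ⟨0, interior_mono Metric.ball_subset_closedBall (by simp [Metric.isOpen_ball.interior_eq])⟩

/-- The chain rule within the disc exhibits the derivative of `Ψ'` as a left inverse. Boundary
points are included because derivatives within a convex set with interior are unique. -/
theorem fderivWithin_injective_of_invOn
    (h1 : ContDiffOn ℝ ∞ Ψ (Metric.closedBall 0 1))
    (h2 : ContDiffOn ℝ ∞ Ψ' (Metric.closedBall 0 1))
    (h3 : Set.MapsTo Ψ (Metric.closedBall 0 1) (Metric.closedBall 0 1))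
    (h5 : Set.LeftInvOn Ψ' Ψ (Metric.closedBall 0 1))
    {v : V (l + 1)} (hv : v ∈ Metric.closedBall (0 : V (l + 1)) 1) {u : V (l + 1)}
    (hu : fderivWithin ℝ Ψ (Metric.closedBall 0 1) v u = 0) : u = 0 := by
  have g1 := ((h1.differentiableOn (by simp)) v hv).hasFDerivWithinAt
  have g2 := ((h2.differentiableOn (by simp)) _ (h3 hv)).hasFDerivWithinAt
  have g3 := (g2.comp v g1 h3).congr_of_eventuallyEq (f₁ := id)
    (by filter_upwards [self_mem_nhdsWithin] with w hw using (h5 hw).symm) (h5 hv).symm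
  have g4 := (uniqueDiffOn_disc v hv).eq g3 (hasFDerivWithinAt_id v _)
  have g5 := congrArg (fun L : V (l + 1) →L[ℝ] V (l + 1) => L u) g4
  simpa [hu] using g5.symm

/-- A unit tangent vector is the velocity of a great circle through `x`, and along that circle `Ψ`
and the radial extension agree. -/
theorem fderivWithin_eq_fderiv_radial (h1 : ContDiffOn ℝ ∞ Ψ (Metric.closedBall 0 1))
    (h6 : ∀ x : S l, Ψ x = ψ x) (x : S l) {u : V (l + 1)}
    (hu : inner ℝ (x : V (l + 1)) u = 0) :
    fderivWithin ℝ Ψ (Metric.closedBall 0 1) x u = fderiv ℝ (radial ψ) x u := by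
  by_cases hu0 : u = 0
  · simp [hu0]
  obtain ⟨w, hw⟩ : ∃ w : V (l + 1), w = ‖u‖⁻¹ • u := ⟨_, rfl⟩
  have hun : ‖u‖ ≠ 0 := norm_ne_zero_iff.2 hu0
  have hwn : ‖w‖ = 1 := by rw [hw, norm_smul, norm_inv, norm_norm, inv_mul_cancel₀ hun]
  have hwx : inner ℝ (x : V (l + 1)) w = 0 := by rw [hw, inner_smul_right, hu, mul_zero]
  have huw : u = ‖u‖ • w := by rw [hw, smul_smul, mul_inv_cancel₀ hun, one_smul]
  let c : ℝ → V (l + 1) := fun t => Real.cos t • (x : V (l + 1)) + Real.sin t • w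
  have hcn (t : ℝ) : ‖c t‖ = 1 := by
    have : ‖c t‖ ^ 2 = 1 := by
      rw [norm_add_sq_real, norm_smul, norm_smul, inner_smul_left, inner_smul_right, hwx, hwn]
      simp [Real.cos_sq_add_sin_sq]
    exact (pow_eq_one_iff_of_nonneg (norm_nonneg _) two_ne_zero).1 this
  have hc : HasDerivAt c w 0 := by
    have := ((Real.hasDerivAt_cos 0).smul_const (x : V (l + 1))).add
      ((Real.hasDerivAt_sin 0).smul_const w)
    simp only [Real.sin_zero, neg_zero, zero_smul, Real.cos_zero, one_smul, zero_add] at this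
    exact this
  have hc0 : c 0 = x := by simp [c]
  have g1 : HasFDerivWithinAt Ψ (fderivWithin ℝ Ψ (Metric.closedBall 0 1) x)
      (Metric.closedBall 0 1) (c 0) := by
    rw [hc0]
    exact ((h1.differentiableOn (by simp)) _ (by simp)).hasFDerivWithinAt
  have g2 : HasFDerivAt (radial ψ) (fderiv ℝ (radial ψ) x) (c 0) := by
    rw [hc0]; exact hasFDerivAt_radial ψ (coe_ne_zero x)
  have g3 := g1.comp_hasDerivAt 0 hc (.of_forall fun t => by simp [hcn])
  have g4 := g2.comp_hasDerivAt 0 hc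
  have g5 : Ψ ∘ c = radial ψ ∘ c := by
    ext1 t
    let z : S l := ⟨c t, by simp [hcn]⟩
    exact (h6 z).trans (radial_coe ψ z).symm
  rw [g5] at g3
  rw [huw, map_smul, map_smul, g3.unique g4]

/-- Not negative: the inner product of `ψ x` with `Ψ` is maximal at `x` on the disc, so it cannot
increase in the inward direction `-x`. Not zero: otherwise the derivative would send `x` into the
tangent space at `ψ x`, which is already the image of the tangent space at `x`, against injectivity.
-/
theorem inner_fderivWithin_pos
    (h1 : ContDiffOn ℝ ∞ Ψ (Metric.closedBall 0 1))
    (h2 : ContDiffOn ℝ ∞ Ψ' (Metric.closedBall 0 1))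
    (h3 : Set.MapsTo Ψ (Metric.closedBall 0 1) (Metric.closedBall 0 1))
    (h5 : Set.LeftInvOn Ψ' Ψ (Metric.closedBall 0 1))
    (h6 : ∀ x : S l, Ψ x = ψ x) (x : S l) :
    0 < inner ℝ (ψ x : V (l + 1)) (fderivWithin ℝ Ψ (Metric.closedBall 0 1) x x) := by
  have hx : (x : V (l + 1)) ∈ Metric.closedBall (0 : V (l + 1)) 1 := by simp
  refine lt_of_le_of_ne ?_ fun h0 => ?_
  · have g1 := (innerSL ℝ (ψ x : V (l + 1))).hasFDerivAt.comp_hasFDerivWithinAt (x : V (l + 1))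
      ((h1.differentiableOn (by simp)) _ hx).hasFDerivWithinAt
    have g2 : IsLocalMaxOn (innerSL ℝ (ψ x : V (l + 1)) ∘ Ψ) (Metric.closedBall 0 1) x := by
      filter_upwards [self_mem_nhdsWithin] with v hv
      have hv' : ‖Ψ v‖ ≤ 1 := by simpa using h3 hv
      simp only [Function.comp_apply, innerSL_apply_apply, h6]
      calc _ ≤ ‖(ψ x : V (l + 1))‖ * ‖Ψ v‖ := real_inner_le_norm _ _
        _ ≤ 1 := by simpa using hv'
        _ = _ := by simp
    have g3 := g2.hasFDerivWithinAt_nonpos g1 (y := 0 - (x : V (l + 1)))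
      (sub_mem_posTangentConeAt_of_segment_subset
        ((convex_closedBall (0 : V (l + 1)) 1).segment_subset hx (by simp)))
    simpa using g3
  · obtain ⟨T, hT⟩ := isUnit_fderiv_radial ψ (coe_ne_zero x)
    set w := fderivWithin ℝ Ψ (Metric.closedBall 0 1) (x : V (l + 1)) x with hw
    set u : V (l + 1) := (↑T⁻¹ : V (l + 1) →L[ℝ] V (l + 1)) w with hu
    have hTu : fderiv ℝ (radial ψ) x u = w := by
      rw [← hT, hu]
      exact congrArg (fun L : V (l + 1) →L[ℝ] V (l + 1) => L w) T.mul_inv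
    have hxu : inner ℝ (x : V (l + 1)) u = 0 := by
      rw [← inner_fderiv_radial ψ, hTu]; exact h0.symm
    have g1 := fderivWithin_eq_fderiv_radial h1 h6 x hxu
    have g2 : (x : V (l + 1)) - u = 0 :=
      fderivWithin_injective_of_invOn h1 h2 h3 h5 hx (by rw [map_sub, g1, hTu, ← hw, sub_self])
    rw [← sub_eq_zero.1 g2] at hxu
    simp at hxu

/-- At boundary points, all convex combinations of the derivatives of `Ψ` and of the radial
extension of its restriction are invertible. -/
theorem isUnit_combination_of_boundary
    (h1 : ContDiffOn ℝ ∞ Ψ (Metric.closedBall 0 1))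
    (h2 : ContDiffOn ℝ ∞ Ψ' (Metric.closedBall 0 1))
    (h3 : Set.MapsTo Ψ (Metric.closedBall 0 1) (Metric.closedBall 0 1))
    (h5 : Set.LeftInvOn Ψ' Ψ (Metric.closedBall 0 1))
    (h6 : ∀ x : S l, Ψ x = ψ x) (x : S l) {μ : ℝ} (hμ : μ ∈ Set.Icc (0 : ℝ) 1) :
    IsUnit ((1 - μ) • fderiv ℝ (radial ψ) x +
      μ • fderivWithin ℝ Ψ (Metric.closedBall 0 1) (x : V (l + 1))) := by
  refine isUnit_of_injective fun z hz => ?_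
  obtain ⟨s, u, hxu, hzu⟩ : ∃ (s : ℝ) (u : V (l + 1)), inner ℝ (x : V (l + 1)) u = 0 ∧
      z = u + s • (x : V (l + 1)) := by
    refine ⟨inner ℝ (x : V (l + 1)) z, z - inner ℝ (x : V (l + 1)) z • (x : V (l + 1)), ?_, ?_⟩
    · rw [inner_sub_right, inner_smul_right]; simp
    · abel
  have g1 := fderivWithin_eq_fderiv_radial h1 h6 x hxu
  have ha := inner_fderivWithin_pos h1 h2 h3 h5 h6 x
  set D := fderivWithin ℝ Ψ (Metric.closedBall 0 1) (x : V (l + 1))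
  have g2 : fderiv ℝ (radial ψ) x u + s • ((1 - μ) • (ψ x : V (l + 1)) + μ • D x) = 0 := by
    refine Eq.trans ?_ hz
    simp only [hzu, add_apply, smul_apply, map_add,
      map_smul, g1, fderiv_radial_self]
    module
  -- Pairing with `ψ x` isolates the normal coefficient `s`, multiplied by a convex combination of
  -- two positive numbers. Hence `s = 0`, and the tangential part lies in the kernel of the
  -- invertible derivative of `radial ψ`.
  have g3 := congrArg (fun w => inner ℝ (ψ x : V (l + 1)) w) g2
  simp only [inner_add_right, inner_smul_right, inner_fderiv_radial, hxu, inner_zero_right] at g3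
  have g4 : s = 0 := by
    simp only [real_inner_self_eq_norm_sq, norm_eq_of_mem_sphere, one_pow, mul_one, zero_add] at g3
    refine (mul_eq_zero.1 g3).resolve_right (ne_of_gt ?_)
    rcases eq_or_lt_of_le hμ.1 with h | h
    · rw [← h]; simp
    · have := mul_pos h ha
      linarith [hμ.2]
  rw [g4, zero_smul, add_zero] at g2
  rw [hzu, g4, zero_smul, add_zero]
  by_contra hne
  exact apply_ne_zero_of_isUnit (isUnit_fderiv_radial ψ (coe_ne_zero x)) hne g2

/-- Compactness spreads the invertibility at the boundary to a shell. The pairs `(v, μ)` with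
singular combination form a compact set whose norms avoid 1, hence a neighbourhood of 1; on a
smaller compact shell there is a uniform margin `ρ`. The bound `δ ≤ 1 / 2` keeps the origin out. -/
theorem exists_shell
    (h1 : ContDiffOn ℝ ∞ Ψ (Metric.closedBall 0 1))
    (h2 : ContDiffOn ℝ ∞ Ψ' (Metric.closedBall 0 1))
    (h3 : Set.MapsTo Ψ (Metric.closedBall 0 1) (Metric.closedBall 0 1))
    (h5 : Set.LeftInvOn Ψ' Ψ (Metric.closedBall 0 1))
    (h6 : ∀ x : S l, Ψ x = ψ x) :
    ∃ δ > 0, δ ≤ 1 / 2 ∧ ∃ ρ > 0, ∀ v : V (l + 1), 1 - δ ≤ ‖v‖ → ‖v‖ ≤ 1 →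
      ∀ μ ∈ Set.Icc (0 : ℝ) 1, ∀ T : V (l + 1) →L[ℝ] V (l + 1),
        ‖T - ((1 - μ) • fderiv ℝ (radial ψ) v +
          μ • fderivWithin ℝ Ψ (Metric.closedBall 0 1) v)‖ < ρ → IsUnit T := by
  let L : V (l + 1) × ℝ → V (l + 1) →L[ℝ] V (l + 1) := fun p =>
    (1 - p.2) • fderiv ℝ (radial ψ) p.1 + p.2 • fderivWithin ℝ Ψ (Metric.closedBall 0 1) p.1
  let K (δ : ℝ) : Set (V (l + 1) × ℝ) := {v | 1 - δ ≤ ‖v‖ ∧ ‖v‖ ≤ 1} ×ˢ Set.Icc 0 1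
  have hK (δ : ℝ) : IsCompact (K δ) := by
    refine IsCompact.prod ?_ isCompact_Icc
    refine (isCompact_closedBall (0 : V (l + 1)) 1).of_isClosed_subset ?_
      fun v hv => by simpa using hv.2
    exact (isClosed_le continuous_const continuous_norm).inter
      (isClosed_le continuous_norm continuous_const)
  have hL {δ : ℝ} (hδ : δ ≤ 1 / 2) : ContinuousOn L (K δ) := by
    have g1 : ContinuousOn (fderiv ℝ (radial ψ)) {v | 1 - δ ≤ ‖v‖ ∧ ‖v‖ ≤ 1} := by
      intro v hv
      have hv0 : v ≠ 0 := norm_pos_iff.1 (by linarith [hv.1])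
      exact ((contDiffAt_radial ψ.contMDiff hv0).fderiv_right (m := 0)
        (by simp)).continuousAt.continuousWithinAt
    have g2 : ContinuousOn (fderivWithin ℝ Ψ (Metric.closedBall 0 1))
        {v | 1 - δ ≤ ‖v‖ ∧ ‖v‖ ≤ 1} :=
      (h1.continuousOn_fderivWithin uniqueDiffOn_disc (by simp)).mono
        fun v hv => by simpa using hv.2
    exact ((continuousOn_const.sub continuousOn_snd).smul
        (g1.comp continuousOn_fst fun p hp => hp.1)).add
      (continuousOn_snd.smul (g2.comp continuousOn_fst fun p hp => hp.1))
  have hunits := Units.isOpen (R := V (l + 1) →L[ℝ] V (l + 1))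
  have hZ : IsCompact (K (1 / 2) ∩ L ⁻¹' {T | IsUnit T}ᶜ) :=
    (hK _).of_isClosed_subset ((hL le_rfl).preimage_isClosed_of_isClosed (hK _).isClosed
      hunits.isClosed_compl) Set.inter_subset_left
  have hC := (hZ.image (continuous_fst.norm)).isClosed
  have h1C : (1 : ℝ) ∈ ((fun p : V (l + 1) × ℝ => ‖p.1‖) ''
      (K (1 / 2) ∩ L ⁻¹' {T | IsUnit T}ᶜ))ᶜ := by
    rintro ⟨⟨v, μ⟩, ⟨hp1, hp2⟩, hv⟩
    exact hp2 (isUnit_combination_of_boundary h1 h2 h3 h5 h6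
      ⟨v, by simpa using hv⟩ hp1.2)
  obtain ⟨ε, hε, hball⟩ := Metric.isOpen_iff.1 hC.isOpen_compl 1 h1C
  set δ := min (1 / 2) (ε / 2) with hδ
  have hδpos : 0 < δ := lt_min (by norm_num) (by linarith)
  have hδ2 : δ ≤ 1 / 2 := min_le_left _ _
  have hδε : δ < ε := (min_le_right _ _).trans_lt (by linarith)
  have hU : L '' K δ ⊆ {T | IsUnit T} := by
    rintro _ ⟨⟨v, μ⟩, ⟨⟨hv1, hv2⟩, hμ⟩, rfl⟩
    by_contra hnu
    refine hball (a := ‖v‖) ?_ ⟨(v, μ), ⟨⟨⟨?_, hv2⟩, hμ⟩, hnu⟩, rfl⟩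
    · dsimp only at hv1 hv2
      rw [Metric.mem_ball, Real.dist_eq, abs_lt]
      constructor <;> linarith
    · dsimp only at hv1
      linarith
  obtain ⟨ρ, hρ, hth⟩ := ((hK δ).image_of_continuousOn (hL hδ2)).exists_thickening_subset_open
    hunits hU
  refine ⟨δ, hδpos, hδ2, ρ, hρ, fun v hv1 hv2 μ hμ T hT => hth ?_⟩
  rw [Metric.mem_thickening_iff]
  exact ⟨L (v, μ), ⟨(v, μ), ⟨⟨hv1, hv2⟩, hμ⟩, rfl⟩, by rwa [dist_eq_norm]⟩

/-- Both maps agree at the boundary point `dir v`, which has distance `1 - ‖v‖` from `v` (for `v` in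
the disc); the mean value inequality bounds the change of `Ψ`, and the radial map moves by exactly
this distance. -/
theorem exists_norm_sub_radial_le (h1 : ContDiffOn ℝ ∞ Ψ (Metric.closedBall 0 1))
    (h6 : ∀ x : S l, Ψ x = ψ x) :
    ∃ M > 0, ∀ v : V (l + 1), ‖v‖ ≤ 1 → ‖Ψ v - radial ψ v‖ ≤ M * (1 - ‖v‖) := by
  obtain ⟨C, hC⟩ := (isCompact_closedBall (0 : V (l + 1)) 1).exists_bound_of_continuousOn
    (h1.continuousOn_fderivWithin uniqueDiffOn_disc (by simp))
  refine ⟨max C 0 + 1, by positivity, fun v hv => ?_⟩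
  have hvd : v - dir v = -((1 - ‖v‖) • (dir v : V (l + 1))) := by
    calc v - dir v = ‖v‖ • (dir v : V (l + 1)) - dir v := by rw [norm_smul_dir]
      _ = _ := by module
  have g1 : ‖Ψ v - Ψ (dir v)‖ ≤ max C 0 * (1 - ‖v‖) := by
    have := (convex_closedBall (0 : V (l + 1)) 1).norm_image_sub_le_of_norm_fderivWithin_le
      (h1.differentiableOn (by simp)) (fun x hx => (hC x hx).trans (le_max_left C 0))
      (x := (dir v : V (l + 1))) (y := v) (by simp) (by simpa using hv)
    rwa [hvd, norm_neg, norm_smul_coe (by linarith)] at this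
  have g2 : ‖Ψ (dir v) - radial ψ v‖ = 1 - ‖v‖ := by
    rw [h6, radial, show (ψ (dir v) : V (l + 1)) - ‖v‖ • (ψ (dir v) : V (l + 1)) =
      (1 - ‖v‖) • (ψ (dir v) : V (l + 1)) by module, norm_smul_coe (by linarith)]
  calc _ ≤ ‖Ψ v - Ψ (dir v)‖ + ‖Ψ (dir v) - radial ψ v‖ := norm_sub_le_norm_sub_add_norm_sub _ _ _
    _ ≤ _ := by rw [g2]; linarith

/-- A diffeomorphism of the sphere that extends to the disc has an extension to a diffeomorphism
of `ℝ^{l+1}` that is radial outside the disc. -/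
theorem ExtendsToDisc.exists_radial_extension (h : ExtendsToDisc ψ) :
    ∃ Θ Θ' : V (l + 1) → V (l + 1), ContDiff ℝ ∞ Θ ∧ ContDiff ℝ ∞ Θ' ∧
      (∀ v, Θ' (Θ v) = v) ∧ (∀ v, Θ (Θ' v) = v) ∧ ∀ v, 1 ≤ ‖v‖ → Θ v = radial ψ v := by
  obtain ⟨Ψ, Ψ', h1, h2, h3, h4, h5, h6⟩ := h
  obtain ⟨δ, hδ, hδ2, ρ, hρ, hshell⟩ := exists_shell h1 h2 h3 h5.1 h6
  obtain ⟨M, hM, hMb⟩ := exists_norm_sub_radial_le h1 h6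
  -- The derivative of the interpolation `Θ₀` is a convex combination as in `exists_shell` plus the
  -- rank one term `χ' · (Ψ - radial ψ)`, of norm at most `|χ'| M (1 - ‖v‖)`. The choice of `κ`
  -- makes this at most `ρ / 2`. The width `δ / 2` keeps the whole transition region inside the
  -- shell.
  obtain ⟨χ, hχ, hχ1, ⟨δ', hδ', hχ0⟩, hχI, hχd⟩ := exists_log_cutoff (δ := δ / 2)
    (κ := ρ / (2 * M)) (by linarith) (by positivity)
  let Θ₀ : V (l + 1) → V (l + 1) := fun v => radial ψ v + χ ‖v‖ • (Ψ v - radial ψ v)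
  let Θ : V (l + 1) → V (l + 1) := fun v => if ‖v‖ < 1 then Θ₀ v else radial ψ v
  have hin (v : V (l + 1)) (hv : ‖v‖ < 1 - δ / 2) : Θ =ᶠ[nhds v] Ψ := by
    filter_upwards [(isOpen_lt continuous_norm continuous_const).mem_nhds hv] with w hw
    have hw' : ‖w‖ < 1 - δ / 2 := hw
    simp only [Θ, Θ₀]
    rw [if_pos (by linarith), hχ1 _ hw'.le, one_smul]
    abel
  have hout' (v : V (l + 1)) (hv : 1 - δ' ≤ ‖v‖) : Θ v = radial ψ v := by
    simp only [Θ, Θ₀]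
    split_ifs with h
    · rw [hχ0 _ hv, zero_smul, add_zero]
    · rfl
  have hout (v : V (l + 1)) (hv : 1 ≤ ‖v‖) : Θ =ᶠ[nhds v] radial ψ := by
    filter_upwards [(isOpen_lt continuous_const continuous_norm).mem_nhds
      (show 1 - δ' < ‖v‖ by linarith)] with w hw
    exact hout' w (le_of_lt hw)
  have hmid (v : V (l + 1)) (hv : ‖v‖ < 1) : Θ =ᶠ[nhds v] Θ₀ := by
    filter_upwards [(isOpen_lt continuous_norm continuous_const).mem_nhds hv] with w hw
    exact if_pos hw
  have hΨ (v : V (l + 1)) (hv : ‖v‖ < 1) : ContDiffAt ℝ ∞ Ψ v :=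
    h1.contDiffAt (Filter.mem_of_superset (Metric.isOpen_ball.mem_nhds (by simpa using hv))
      Metric.ball_subset_closedBall)
  have hfw (v : V (l + 1)) (hv : ‖v‖ < 1) :
      fderivWithin ℝ Ψ (Metric.closedBall 0 1) v = fderiv ℝ Ψ v :=
    fderivWithin_of_mem_nhds (Filter.mem_of_superset
      (Metric.isOpen_ball.mem_nhds (by simpa using hv)) Metric.ball_subset_closedBall)
  have hsmooth : ContDiff ℝ ∞ Θ := by
    refine contDiff_iff_contDiffAt.2 fun v => ?_
    by_cases hv : ‖v‖ < 1 - δ / 2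
    · exact (hΨ v (by linarith)).congr_of_eventuallyEq (hin v hv)
    have hv0 : v ≠ 0 := norm_pos_iff.1 (by linarith)
    have hP := contDiffAt_radial ψ.contMDiff hv0
    by_cases hv1 : ‖v‖ < 1
    · exact (hP.add ((hχ.contDiffAt.comp v (contDiffAt_norm ℝ hv0)).smul
        ((hΨ v hv1).sub hP))).congr_of_eventuallyEq (hmid v hv1)
    · exact hP.congr_of_eventuallyEq (hout v (not_lt.1 hv1))
  have hunit (v : V (l + 1)) : IsUnit (fderiv ℝ Θ v) := by
    by_cases hv : ‖v‖ < 1 - δ / 2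
    · have hv1 : ‖v‖ < 1 := by linarith
      rw [(hin v hv).fderiv_eq, ← hfw v hv1]
      exact isUnit_of_injective fun u hu =>
        fderivWithin_injective_of_invOn h1 h2 h3 h5.1 (by simpa using hv1.le) hu
    have hv0 : v ≠ 0 := norm_pos_iff.1 (by linarith)
    by_cases hv1 : ‖v‖ < 1
    · rw [(hmid v hv1).fderiv_eq]
      refine hshell v (by linarith) hv1.le (χ ‖v‖) (hχI _) _ ?_
      have d1 := hasFDerivAt_radial ψ hv0
      have d2 := ((hΨ v hv1).differentiableAt (by simp)).hasFDerivAt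
      have d3 := ((contDiffAt_norm ℝ hv0 (n := ∞)).differentiableAt (by simp)).hasFDerivAt
      have d4 := ((hχ.differentiable (by simp) ‖v‖).hasDerivAt).comp_hasFDerivAt v d3
      have d5 := d1.add (d4.smul (d2.sub d1))
      have d6 : fderiv ℝ Θ₀ v = _ := d5.fderiv
      rw [d6, hfw v hv1]
      set N := fderiv ℝ (fun v : V (l + 1) => ‖v‖) v
      have hN : ‖N‖ ≤ 1 := by
        simpa using norm_fderiv_le_of_lipschitz ℝ (x₀ := v)
          (lipschitzWith_one_norm (E := V (l + 1)))
      have e1 : fderiv ℝ (radial ψ) v + ((χ ∘ fun v : V (l + 1) => ‖v‖) v •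
          (fderiv ℝ Ψ v - fderiv ℝ (radial ψ) v) +
            (deriv χ ‖v‖ • N).smulRight (Ψ v - radial ψ v)) -
          ((1 - χ ‖v‖) • fderiv ℝ (radial ψ) v + χ ‖v‖ • fderiv ℝ Ψ v) =
          (deriv χ ‖v‖ • N).smulRight (Ψ v - radial ψ v) := by
        simp only [Function.comp_apply]
        module
      calc _ = ‖(deriv χ ‖v‖ • N).smulRight (Ψ v - radial ψ v)‖ := congrArg _ e1
        _ = |deriv χ ‖v‖| * ‖N‖ * ‖Ψ v - radial ψ v‖ := by
            rw [ContinuousLinearMap.norm_smulRight_apply, norm_smul, Real.norm_eq_abs]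
        _ ≤ |deriv χ ‖v‖| * 1 * (M * (1 - ‖v‖)) := by
            gcongr
            exact hMb v hv1.le
        _ = M * (|deriv χ ‖v‖| * (1 - ‖v‖)) := by ring
        _ ≤ M * (ρ / (2 * M)) := by
            gcongr
            exact hχd _ hv1
        _ < ρ := by
            rw [show M * (ρ / (2 * M)) = ρ / 2 by field_simp]
            linarith
    · rw [(hout v (not_lt.1 hv1)).fderiv_eq]
      exact isUnit_fderiv_radial ψ hv0
  -- A constant family over `ℝ`, as only the inverse of the single map `Θ` is wanted.
  obtain ⟨g, hg, hl, hr⟩ := exists_family_inverse (W := ℝ) (f := fun p => Θ p.2) isOpen_univ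
    (fun A _ v => hsmooth.contDiffAt.comp (A, v) contDiffAt_snd) (fun A _ v => hunit v)
    (fun A _ => ⟨ψ, fun v hv => hout' v (by linarith)⟩)
  refine ⟨Θ, fun v => g (0, v), hsmooth, ?_, hl 0 trivial, hr 0 trivial,
    fun v hv => hout' v (by linarith)⟩
  exact contDiff_iff_contDiffAt.2 fun v =>
    (hg 0 trivial v).comp v (contDiffAt_const.prodMk contDiffAt_id)

end Collar

/-! ## Smooth representatives -/

section GramSchmidt

variable {n : ℕ}

open InnerProductSpace

theorem contDiffAt_gramSchmidt {w : Fin n → V n} (hw : LinearIndependent ℝ w) (i : Fin n) :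
    ContDiffAt ℝ ∞ (fun w : Fin n → V n => gramSchmidt ℝ w i) w := by
  induction i using WellFoundedLT.induction with
  | ind i ih =>
    have hi : ContDiffAt ℝ ∞ (fun w : Fin n → V n => w i) w := (contDiff_apply ℝ (V n) i).contDiffAt
    have h : (fun w : Fin n → V n => gramSchmidt ℝ w i) = fun w => w i - ∑ j ∈ Finset.Iio i,
        (inner ℝ (gramSchmidt ℝ w j) (w i) / ‖gramSchmidt ℝ w j‖ ^ 2) • gramSchmidt ℝ w j := by
      ext1 w
      exact eq_sub_of_add_eq (gramSchmidt_def'' ℝ w i).symm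
    rw [h]
    refine hi.sub (ContDiffAt.sum fun j hj => ?_)
    have hj' := ih j (Finset.mem_Iio.1 hj)
    refine ((hj'.inner ℝ hi).div (hj'.norm_sq ℝ) ?_).smul hj'
    exact pow_ne_zero 2 (norm_ne_zero_iff.2 (gramSchmidt_ne_zero j hw))

theorem contDiffAt_gramSchmidtNormed {w : Fin n → V n} (hw : LinearIndependent ℝ w) (i : Fin n) :
    ContDiffAt ℝ ∞ (fun w : Fin n → V n => gramSchmidtNormed ℝ w i) w := by
  have h := contDiffAt_gramSchmidt hw i
  have h0 := gramSchmidt_ne_zero i hw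
  exact ((h.norm ℝ h0).inv (norm_ne_zero_iff.2 h0)).smul h

/-- The matrix whose columns are obtained by Gram–Schmidt orthonormalization. -/
def gsMatrix (w : Fin n → V n) : Matrix (Fin n) (Fin n) ℝ :=
  Matrix.of fun i j => gramSchmidtNormed ℝ w j i

/-- The columns of a matrix, as vectors of the Euclidean space. -/
def euclideanCols (A : Matrix (Fin n) (Fin n) ℝ) (j : Fin n) : V n := WithLp.toLp 2 fun i => A i j

theorem contDiffAt_gsMatrix_apply {w : Fin n → V n} (hw : LinearIndependent ℝ w) (i j : Fin n) :
    ContDiffAt ℝ ∞ (fun w : Fin n → V n => gsMatrix w i j) w :=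
  (EuclideanSpace.proj (𝕜 := ℝ) i).contDiff.contDiffAt.comp w (contDiffAt_gramSchmidtNormed hw j)

theorem gsMatrix_mem_orthogonalGroup {w : Fin n → V n} (hw : LinearIndependent ℝ w) :
    gsMatrix w ∈ Matrix.orthogonalGroup (Fin n) ℝ := by
  rw [Matrix.mem_orthogonalGroup_iff']
  ext i j
  have h := orthonormal_iff_ite.1 (gramSchmidtNormed_orthonormal hw) i j
  rw [Matrix.one_apply, ← h, Matrix.mul_apply, PiLp.inner_apply]
  exact Finset.sum_congr rfl fun a _ => by
    simp [gsMatrix, mul_comm]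

theorem orthonormal_euclideanCols {A : Matrix (Fin n) (Fin n) ℝ}
    (hA : A ∈ Matrix.orthogonalGroup (Fin n) ℝ) : Orthonormal ℝ (euclideanCols A) := by
  rw [Matrix.mem_orthogonalGroup_iff'] at hA
  rw [orthonormal_iff_ite]
  intro i j
  have h := congrFun (congrFun hA i) j
  rw [Matrix.one_apply] at h
  rw [← h, Matrix.mul_apply, PiLp.inner_apply]
  exact Finset.sum_congr rfl fun a _ => by
    simp [euclideanCols, mul_comm]

/-- Gram–Schmidt fixes orthonormal systems; thus `gsMatrix` is a smooth retraction of the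
independent frames onto the orthogonal group. -/
theorem gsMatrix_euclideanCols {A : Matrix (Fin n) (Fin n) ℝ}
    (hA : A ∈ Matrix.orthogonalGroup (Fin n) ℝ) : gsMatrix (euclideanCols A) = A := by
  have h := orthonormal_euclideanCols hA
  ext i j
  rw [gsMatrix, Matrix.of_apply, gramSchmidtNormed,
    gramSchmidt_of_orthogonal ℝ (fun i j hij => h.2 hij), h.1 j]
  simp [euclideanCols]

theorem continuous_euclideanCols :
    Continuous fun A : Matrix (Fin n) (Fin n) ℝ => euclideanCols A := by
  refine continuous_pi fun j => (PiLp.continuous_toLp 2 _).comp (continuous_pi fun i => ?_)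
  exact continuous_id.matrix_elem i j

theorem gsMatrix_mem_specialOrthogonalGroup {w : Fin n → V n} (hw : LinearIndependent ℝ w)
    (hd : (gsMatrix w).det = 1) : gsMatrix w ∈ Matrix.specialOrthogonalGroup (Fin n) ℝ :=
  Matrix.mem_specialOrthogonalGroup_iff.2 ⟨gsMatrix_mem_orthogonalGroup hw, hd⟩

theorem continuousAt_gsMatrix {w : Fin n → V n} (hw : LinearIndependent ℝ w) :
    ContinuousAt (gsMatrix (n := n)) w :=
  continuousAt_pi.2 fun i => continuousAt_pi.2 fun j => (contDiffAt_gsMatrix_apply hw i j).continuousAt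

theorem det_gsMatrix_sq {w : Fin n → V n} (hw : LinearIndependent ℝ w) :
    (gsMatrix w).det ^ 2 = 1 := by
  have h := (Matrix.mem_orthogonalGroup_iff' (Fin n) ℝ).1 (gsMatrix_mem_orthogonalGroup hw)
  have h2 := congrArg Matrix.det h
  rw [Matrix.det_mul, Matrix.det_one] at h2
  rw [sq]
  simpa [Matrix.star_eq_conjTranspose, Matrix.det_transpose] using h2

/-- On the connected ball the determinant is continuous with square 1, hence constant, and it is 1
at the centre. -/
theorem det_gsMatrix_eq_one {A : Matrix (Fin n) (Fin n) ℝ}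
    (hA : A ∈ Matrix.specialOrthogonalGroup (Fin n) ℝ) {ε : ℝ}
    (hε : ∀ w ∈ Metric.ball (euclideanCols A) ε, LinearIndependent ℝ w) {w : Fin n → V n}
    (hw : w ∈ Metric.ball (euclideanCols A) ε) : (gsMatrix w).det = 1 := by
  have hSO := Matrix.mem_specialOrthogonalGroup_iff.1 hA
  have hc : euclideanCols A ∈ Metric.ball (euclideanCols A) ε :=
    Metric.mem_ball_self (dist_nonneg.trans_lt hw)
  have hcont : ContinuousOn (fun w : Fin n → V n => (gsMatrix w).det)
      (Metric.ball (euclideanCols A) ε) := fun w hw =>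
    (Continuous.continuousAt (f := Matrix.det) (continuous_id.matrix_det)).comp
      (continuousAt_gsMatrix (hε w hw)) |>.continuousWithinAt
  refine (convex_ball (euclideanCols A) ε).isPreconnected.eq_of_sq_eq (g := fun _ => (1 : ℝ))
    hcont continuousOn_const (fun w hw => ?_) (fun _ => one_ne_zero) hc ?_ hw
  · simpa using det_gsMatrix_sq (hε w hw)
  · rw [gsMatrix_euclideanCols hSO.1, hSO.2]

/-- Every element of `π_k SO(n)` has a smooth representative. -/
theorem exists_smooth_representative {k : ℕ} (c : PiSphere k (SO n) 1) :
    ∃ β : SmoothSO k n, β.Represents c := by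
  induction c using Quotient.inductionOn with
  | h α =>
  obtain ⟨α, hα⟩ := α
  let a : S k → Fin n → V n := fun y => euclideanCols (α y : Matrix (Fin n) (Fin n) ℝ)
  have ha : Continuous a :=
    continuous_euclideanCols.comp (continuous_subtype_val.comp α.continuous)
  have hO (y : S k) := (Matrix.mem_specialOrthogonalGroup_iff.1 (α y).2).1
  obtain ⟨ε, hε, hth⟩ := (isCompact_range ha).exists_thickening_subset_open
    (isOpen_setOfPred_linearIndependent (𝕜 := ℝ)) (by
      rintro _ ⟨y, rfl⟩
      exact (orthonormal_euclideanCols (hO y)).linearIndependent)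
  have hli (y : S k) (w : Fin n → V n) (hw : w ∈ Metric.ball (a y) ε) : LinearIndependent ℝ w :=
    hth (Metric.mem_thickening_iff.2 ⟨a y, ⟨y, rfl⟩, hw⟩)
  have hdet (y : S k) (w : Fin n → V n) (hw : w ∈ Metric.ball (a y) ε) : (gsMatrix w).det = 1 :=
    det_gsMatrix_eq_one (α y).2 (hli y) hw
  -- The constant `a x` works near `x`, and convexity allows gluing by a partition of unity. The
  -- second condition, which binds only at `pole k`, keeps the approximation based.
  obtain ⟨g, hg⟩ := exists_contMDiffMap_forall_mem_convex_of_local_const (I := 𝓡 k) (n := (⊤ : ℕ∞))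
    (t := fun y : S k => {w | w ∈ Metric.ball (a y) ε ∧ (y = pole k → w = a (pole k))})
    (fun y => (convex_ball (a y) ε).inter (convex_singleton _).setOfPred_const_imp) (fun x => by
      refine ⟨a x, ?_⟩
      have h1 : ∀ᶠ y in nhds x, a x ∈ Metric.ball (a y) ε :=
        (continuous_const.dist ha).continuousAt.eventually_lt continuousAt_const (by simpa using hε)
      by_cases hx : x = pole k
      · filter_upwards [h1] with y hy using ⟨hy, fun _ => by rw [hx]⟩
      · filter_upwards [h1, isOpen_ne.mem_nhds hx] with y hy hy' using ⟨hy, fun h => absurd h hy'⟩)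
  -- The straight line homotopy stays in balls of independent frames, so it can be orthonormalized
  -- into `SO n`; it is constant at the base point.
  let w : unitInterval × S k → Fin n → V n := fun p => AffineMap.lineMap (a p.2) (g p.2) (p.1 : ℝ)
  have hw (p) : w p ∈ Metric.ball (a p.2) ε :=
    (convex_ball (a p.2) ε).lineMap_mem (Metric.mem_ball_self hε) (hg p.2).1 p.1.2
  have hwc : Continuous w := by
    have := g.contMDiff.continuous
    simp only [w, AffineMap.lineMap_apply]
    fun_prop
  let Φ : C(unitInterval × S k, SO n) :=
    ⟨fun p => ⟨gsMatrix (w p), gsMatrix_mem_specialOrthogonalGroup (hli _ _ (hw p))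
        (hdet _ _ (hw p))⟩,
      Continuous.subtype_mk (continuous_iff_continuousAt.2 fun p =>
        (continuousAt_gsMatrix (hli _ _ (hw p))).comp hwc.continuousAt) _⟩
  have hw0 (y) : w (0, y) = a y := by simp [w]
  have hw1 (y) : w (1, y) = g y := by simp [w]
  have hwp (s) : w (s, pole k) = a (pole k) := by
    simp only [w]
    rw [(hg (pole k)).2 rfl, AffineMap.lineMap_same_apply]
  have hΦ0 (y) : Φ (0, y) = α y := by
    ext1
    change gsMatrix (w (0, y)) = _
    rw [hw0, gsMatrix_euclideanCols (hO y)]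
  have hΦp (s) : Φ (s, pole k) = α (pole k) := by
    ext1
    change gsMatrix (w (s, pole k)) = _
    rw [hwp, gsMatrix_euclideanCols (hO _)]
  let b : C(S k, SO n) := ⟨fun y => Φ (1, y), Φ.continuous.comp (by fun_prop)⟩
  refine ⟨⟨b, fun i j y => ?_⟩, (hΦp 1).trans hα, Quotient.sound (s := basedMapSetoid k (SO n) 1) ?_⟩
  · have h : (fun y => (b y : Matrix (Fin n) (Fin n) ℝ) i j) =
        (fun w : Fin n → V n => gsMatrix w i j) ∘ g := by
      ext1 y
      change gsMatrix (w (1, y)) i j = _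
      rw [hw1]; rfl
    rw [h]
    exact ContMDiffAt.comp y (contDiffAt_gsMatrix_apply (hli y _ (hg y).1) i j).contMDiffAt
      g.contMDiff.contMDiffAt
  · refine ContinuousMap.HomotopicRel.symm ⟨⟨⟨Φ, hΦ0, fun y => rfl⟩, fun s x hx => ?_⟩⟩
    rw [Set.mem_singleton_iff.1 hx]
    exact hΦp s

end GramSchmidt

/-! ## The vanishing of the pairing -/

/-! ### Rotations as invertible linear maps -/

section Rotations

variable {n : ℕ}

/-- The linear map defined by a family of matrix entries. -/
def matCLM : (Fin n → Fin n → ℝ) →L[ℝ] (V n →L[ℝ] V n) :=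
  LinearMap.toContinuousLinearMap
    { toFun := fun A => Matrix.toEuclideanCLM (n := Fin n) (𝕜 := ℝ) (Matrix.of A)
      map_add' := fun A B => map_add (Matrix.toEuclideanCLM (n := Fin n) (𝕜 := ℝ)) (Matrix.of A)
        (Matrix.of B)
      map_smul' := fun r A => map_smul (Matrix.toEuclideanCLM (n := Fin n) (𝕜 := ℝ)) r
        (Matrix.of A) }

/-- A rotation as a linear map. -/
def rotCLM (A : SO n) : V n →L[ℝ] V n := matCLM (A : Matrix (Fin n) (Fin n) ℝ)

theorem rotCLM_eq (A : SO n) :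
    rotCLM A = Matrix.toEuclideanCLM (n := Fin n) (𝕜 := ℝ) (A : Matrix (Fin n) (Fin n) ℝ) := rfl

theorem isUnit_rotCLM (A : SO n) : IsUnit (rotCLM A) := by
  have h (A B : SO n) (h : A * B = 1) : rotCLM A * rotCLM B = 1 := by
    rw [rotCLM_eq, rotCLM_eq, ← map_mul]
    have := congrArg (Subtype.val) h
    simp only [Submonoid.coe_mul, Submonoid.coe_one] at this
    rw [this, map_one]
  exact ⟨⟨rotCLM A, rotCLM A⁻¹, h _ _ (mul_inv_cancel A), h _ _ (inv_mul_cancel A)⟩, rfl⟩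

theorem continuous_rotCLM : Continuous (rotCLM (n := n)) :=
  matCLM.continuous.comp continuous_subtype_val

theorem SmoothSO.contMDiff_rotCLM {k : ℕ} (β : SmoothSO k n) :
    ContMDiff (𝓡 k) 𝓘(ℝ, V n →L[ℝ] V n) ∞ fun y => rotCLM (β.toMap y) := by
  have h : ContMDiff (𝓡 k) 𝓘(ℝ, Fin n → Fin n → ℝ) ∞
      (fun y i j => (β.toMap y : Matrix (Fin n) (Fin n) ℝ) i j) :=
    contMDiff_pi_space.2 fun i => contMDiff_pi_space.2 fun j => β.smooth i j
  exact matCLM.contDiff.contMDiff.comp h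

theorem rotCLM_coe {l : ℕ} (A : SO (l + 1)) (x : S l) : rotCLM A (x : V (l + 1)) = rotate A x := rfl

theorem lin_rotCLM {l : ℕ} (A : SO (l + 1)) (x : S l) : lin (rotCLM A) x = rotate A x := by
  rw [lin, rotCLM_coe, dir_coe]

/-- Equivariance enters here: conjugation by `φ` does not change a rotation commuting with it, and
the radial extension of a rotation is linear. -/
theorem radial_conj_rotCLM {l : ℕ} {φ : SphereDiffeo l} {A : SO (l + 1)}
    (h : ∀ x, φ (rotate A x) = rotate A (φ x)) (v : V (l + 1)) :
    radial (conj φ (rotCLM A)) v = rotCLM A v := by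
  have h1 : conj φ (rotCLM A) (dir v) = rotate A (dir v) := by
    simp only [conj, Function.comp_apply, lin_rotCLM]
    rw [← h, φ.symm_apply_apply]
  rw [radial, h1, ← rotCLM_coe, ← map_smul, norm_smul_dir]

end Rotations

section Vanishing

variable {l k : ℕ}

/-- A homotopy of maps into `SO(l+1)` that ends at a smooth map is approximated by a smooth family
of linear maps with the same end. -/
theorem exists_smooth_homotopy {α : C(S k, SO (l + 1))} {β : SmoothSO k (l + 1)}
    (h : ContinuousMap.Homotopic α β.toMap) {O : Set (V (l + 1) →L[ℝ] V (l + 1))} (hO : IsOpen O)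
    (hα : ∀ y, rotCLM (α y) ∈ O) :
    ∃ g : ℝ × S k → V (l + 1) →L[ℝ] V (l + 1),
      ContMDiff (𝓘(ℝ, ℝ).prod (𝓡 k)) 𝓘(ℝ, V (l + 1) →L[ℝ] V (l + 1)) ∞ g ∧
      (∀ p, IsUnit (g p)) ∧ (∀ y, g (0, y) ∈ O) ∧ ∀ y, g (1, y) = rotCLM (β.toMap y) := by
  obtain ⟨H⟩ := h
  let c : unitInterval × S k → V (l + 1) →L[ℝ] V (l + 1) := fun p => rotCLM (H p)
  have hc : Continuous c := continuous_rotCLM.comp H.continuous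
  -- Clamping `3t - 1` makes the family constant for `t ≤ 1/3` and for `t ≥ 2/3`. It is therefore
  -- smooth on a neighbourhood of `t ≥ 1`, where the approximation may agree with it exactly, and
  -- its values lie in one compact set for all real `t`.
  let h : ℝ × S k → V (l + 1) →L[ℝ] V (l + 1) := fun p =>
    c (Set.projIcc 0 1 zero_le_one (3 * p.1 - 1), p.2)
  have hh : Continuous h := hc.comp (by fun_prop)
  obtain ⟨ε₁, hε₁, hth₁⟩ := (isCompact_range hc).exists_thickening_subset_open
    (Units.isOpen (R := V (l + 1) →L[ℝ] V (l + 1))) (by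
      rintro _ ⟨p, rfl⟩
      exact isUnit_rotCLM _)
  obtain ⟨ε₂, hε₂, hth₂⟩ := (isCompact_range
    (continuous_rotCLM.comp α.continuous)).exists_thickening_subset_open hO (by
      rintro _ ⟨y, rfl⟩
      exact hα y)
  have hU : IsOpen {p : ℝ × S k | 2 / 3 < p.1} := isOpen_lt continuous_const continuous_fst
  have hβ (p : ℝ × S k) (hp : 2 / 3 < p.1) : h p = rotCLM (β.toMap p.2) := by
    have : Set.projIcc (0 : ℝ) 1 zero_le_one (3 * p.1 - 1) = 1 :=
      Set.projIcc_of_right_le _ (by linarith)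
    simp [h, c, this]
  obtain ⟨g, hg1, hg2, -⟩ := hh.exists_contMDiff_approx_and_eqOn (𝓘(ℝ, ℝ).prod (𝓡 k)) (⊤ : ℕ∞)
    (ε := fun _ => min ε₁ ε₂) continuous_const (fun _ => lt_min hε₁ hε₂)
    (S := {p | 1 ≤ p.1}) (U := {p | 2 / 3 < p.1}) (isClosed_le continuous_const continuous_fst)
    (hU.mem_nhdsSet.2 fun p hp => lt_of_lt_of_le (by norm_num : (2 / 3 : ℝ) < 1) hp)
    ((β.contMDiff_rotCLM.comp contMDiff_snd).contMDiffOn.congr hβ)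
  refine ⟨g, g.contMDiff, fun p => hth₁ ?_, fun y => hth₂ ?_, fun y => ?_⟩
  · exact Metric.mem_thickening_iff.2 ⟨h p, ⟨_, rfl⟩, (hg1 p).trans_le (min_le_left _ _)⟩
  · refine Metric.mem_thickening_iff.2 ⟨h (0, y), ⟨y, ?_⟩, (hg1 _).trans_le (min_le_right _ _)⟩
    have : Set.projIcc (0 : ℝ) 1 zero_le_one (-1) = 0 :=
      Set.projIcc_of_le_left _ (by norm_num)
    simp [h, c, this]
  · rw [hg2 (show (1 : ℝ) ≤ ((1 : ℝ), y).1 from le_rfl), hβ _ (by norm_num)]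

/-- The extension is a composite of three maps: `Θ` extends `φ⁻¹ φ'`, then `E` extends `φ⁻¹ g(0, y)
φ`, and the level twist changes `g(0, y)` into `β(y)`. -/
theorem nonempty_tauManifold_diffeo_sphere {φ φ' : SphereDiffeo l}
    (hφ : ExtendsToDisc (φ.symm ∘ φ')) {α : C(S k, SO (l + 1))}
    (hα : ∀ y x, φ (rotate (α y) x) = rotate (α y) (φ x)) {β : SmoothSO k (l + 1)}
    (h : ContinuousMap.Homotopic α β.toMap) :
    Nonempty (TauManifold φ' β ≃ₘ⟮𝓡 (l + k + 1), 𝓡 (l + k + 1)⟯ S (l + k + 1)) := by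
  obtain ⟨Θ, Θ', hΘ, hΘ', hΘl, hΘr, hΘrad⟩ :=
    ExtendsToDisc.exists_radial_extension (ψ := φ'.trans φ.symm) hφ
  obtain ⟨O, hO, hKO, hOu, E, E', hE, hE', hEl, hEr, hErad⟩ :=
    exists_extension_near_commuting φ (isCompact_range (continuous_rotCLM.comp α.continuous))
      (by rintro _ ⟨y, rfl⟩; exact isUnit_rotCLM _)
      (by rintro _ ⟨y, rfl⟩ v; exact radial_conj_rotCLM (hα y) v)
  obtain ⟨g, hg, hgu, hg0, hg1⟩ := exists_smooth_homotopy h hO fun y => hKO ⟨y, rfl⟩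
  -- The twist starts at radius 1, from where on `E` is radial, and is complete at radius 2, as
  -- `nonempty_diffeo_sphere` requires.
  let τ : ℝ → ℝ := fun r => Real.smoothTransition (r - 1)
  have hτ : ContDiff ℝ ∞ τ := Real.smoothTransition.contDiff.comp (contDiff_id.sub contDiff_const)
  have hτ0 {r : ℝ} (hr : r ≤ 1) : τ r = 0 := Real.smoothTransition.zero_of_nonpos (by linarith)
  have hτ1 {r : ℝ} (hr : 2 ≤ r) : τ r = 1 := Real.smoothTransition.one_of_one_le (by linarith)
  have hinv {A : V (l + 1) →L[ℝ] V (l + 1)} (hA : IsUnit A) :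
      ContMDiffAt 𝓘(ℝ, V (l + 1) →L[ℝ] V (l + 1)) 𝓘(ℝ, V (l + 1) →L[ℝ] V (l + 1)) ∞
        Ring.inverse A := by
    obtain ⟨u, rfl⟩ := hA
    exact (contDiffAt_ringInverse ℝ u).contMDiffAt
  have hgτ : ContMDiff (𝓘(ℝ, ℝ).prod (𝓡 k)) 𝓘(ℝ, V (l + 1) →L[ℝ] V (l + 1)) ∞
      (fun p : ℝ × S k => g (τ p.1, p.2)) :=
    hg.comp ((hτ.contMDiff.comp contMDiff_fst).prodMk contMDiff_snd)
  have hgz : ContMDiff (𝓡 k) 𝓘(ℝ, V (l + 1) →L[ℝ] V (l + 1)) ∞ (fun y : S k => g (0, y)) :=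
    hg.comp (contMDiff_const.prodMk contMDiff_id)
  let Q : ℝ × S k → V (l + 1) →L[ℝ] V (l + 1) := fun p =>
    g (τ p.1, p.2) * Ring.inverse (g (0, p.2))
  let Q' : ℝ × S k → V (l + 1) →L[ℝ] V (l + 1) := fun p =>
    g (0, p.2) * Ring.inverse (g (τ p.1, p.2))
  have hQu (p) : IsUnit (Q p) := (hgu _).mul (hgu _).ringInverse
  have hQu' (p) : IsUnit (Q' p) := (hgu _).mul (hgu _).ringInverse
  have hQQ' (p) : Q p * Q' p = 1 := by
    simp only [Q, Q']
    rw [mul_assoc, ← mul_assoc (Ring.inverse _), Ring.inverse_mul_cancel _ (hgu _), one_mul,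
      Ring.mul_inverse_cancel _ (hgu _)]
  have hQ'Q (p) : Q' p * Q p = 1 := by
    simp only [Q, Q']
    rw [mul_assoc, ← mul_assoc (Ring.inverse _), Ring.inverse_mul_cancel _ (hgu _), one_mul,
      Ring.mul_inverse_cancel _ (hgu _)]
  have hQ1 (r : ℝ) (y : S k) (hr : r ≤ 1) : Q (r, y) = 1 := by
    simp only [Q, hτ0 hr]
    exact Ring.mul_inverse_cancel _ (hgu _)
  have hQ1' (r : ℝ) (y : S k) (hr : r ≤ 1) : Q' (r, y) = 1 := by
    simp only [Q', hτ0 hr]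
    exact Ring.mul_inverse_cancel _ (hgu _)
  have hgz' : ContMDiff (𝓘(ℝ, ℝ).prod (𝓡 k)) 𝓘(ℝ, V (l + 1) →L[ℝ] V (l + 1)) ∞
      (fun p : ℝ × S k => g (0, p.2)) := hgz.comp contMDiff_snd
  have hQs : ContMDiff (𝓘(ℝ, ℝ).prod (𝓡 k)) 𝓘(ℝ, V (l + 1) →L[ℝ] V (l + 1)) ∞ Q :=
    hgτ.clm_comp fun p => ContMDiffAt.comp p (hinv (hgu (0, p.2))) (hgz' p)
  have hQs' : ContMDiff (𝓘(ℝ, ℝ).prod (𝓡 k)) 𝓘(ℝ, V (l + 1) →L[ℝ] V (l + 1)) ∞ Q' :=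
    hgz'.clm_comp fun p => ContMDiffAt.comp p (hinv (hgu (τ p.1, p.2))) (hgτ p)
  have hT := contMDiff_levelTwist φ hQs hQu hQ1
  have hT' := contMDiff_levelTwist φ hQs' hQu' hQ1'
  have hfst : ContMDiff (𝓘(ℝ, V (l + 1)).prod (𝓡 k)) 𝓘(ℝ, V (l + 1)) ∞
      (fun p : V (l + 1) × S k => p.1) := contMDiff_fst
  have hgz2 : ContMDiff (𝓘(ℝ, V (l + 1)).prod (𝓡 k)) 𝓘(ℝ, V (l + 1) →L[ℝ] V (l + 1)) ∞
      (fun p : V (l + 1) × S k => g (0, p.2)) := hgz.comp contMDiff_snd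
  refine nonempty_diffeo_sphere (φ := φ)
    (F := fun p => levelTwist φ Q (E (g (0, p.2), Θ p.1), p.2))
    (F' := fun p => Θ' (E' (g (0, p.2), levelTwist φ Q' p))) (fun p => rfl) ?_ ?_ ?_ ?_ ?_
  · refine hT.comp (ContMDiff.prodMk (fun p => ?_) contMDiff_snd)
    exact ContMDiffAt.comp p (hE _ (hg0 p.2) _).contMDiffAt
      ((hgz2.prodMk_space (hΘ.contMDiff.comp hfst)) p)
  · refine hΘ'.contMDiff.comp fun p => ?_
    exact ContMDiffAt.comp p (hE' _ (hg0 p.2) _).contMDiffAt ((hgz2.prodMk_space hT') p)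
  · intro v y
    simp only [levelTwist_levelTwist φ hQu hQ'Q, hEl _ (hg0 y), hΘl]
  · intro v y
    simp only [hΘr, hEr _ (hg0 y), levelTwist_levelTwist φ hQu' hQQ']
  · intro v y hv
    -- Beyond radius 2 all three maps are radial, so the sphere maps compose: `φ⁻¹ Q φ`, `φ⁻¹ g(0,
    -- y) φ` and `φ⁻¹ φ'` give `φ⁻¹ β(y) φ'`.
    have h1 := hΘrad v (by linarith)
    have h2 := hErad _ (hg0 y) (Θ v) (by rw [h1, norm_radial]; linarith)
    have h3 : Q (‖v‖, y) * g (0, y) = rotCLM (β.toMap y) := by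
      simp only [Q, hτ1 hv, hg1]
      rw [mul_assoc, Ring.inverse_mul_cancel _ (hgu _), mul_one]
    simp only [levelTwist, h2]
    rw [norm_radial, h1, norm_radial, radial_radial, radial_radial,
      conj_comp_conj φ _ (hgu _), h3, radial]
    simp only [conj, Function.comp_apply, lin_rotCLM, Diffeomorph.coe_trans,
      Diffeomorph.apply_symm_apply]
    rfl

end Vanishing

end TauPairing

end

theorem mainTheorem6
    {E : Type*} [NormedAddCommGroup E] [NormedSpace ℝ E] [FiniteDimensional ℝ E]
    {H : Type*} [TopologicalSpace H] (I : ModelWithCorners ℝ E H) [I.Boundaryless]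
    (G : Type*) [TopologicalSpace G] [ChartedSpace H G] [Group G] [LieGroup I ∞ G]
    (l : ℕ) [MulAction G (TauPairing.S l)] [IsIsometricSMul G (TauPairing.S l)]
    [ContMDiffSMul I (𝓡 l) ∞ G (TauPairing.S l)]
    (Δ : G →ₜ* TauPairing.SO (l + 1))
    (hΔ : ∀ (g : G) (x : TauPairing.S l), TauPairing.rotate (Δ g) x = g • x)
    (φ : TauPairing.SphereDiffeo l)
    (hφ : ∀ (g : G) (x : TauPairing.S l), φ (g • x) = g • φ x)
    (k : ℕ) (c : TauPairing.PiSphere k G 1) :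
    TauPairing.TauEqZero (TauPairing.Gamma.mk φ)
      (TauPairing.PiSphere.map (Δ : C(G, TauPairing.SO (l + 1))) (map_one Δ) c) := by
  refine ⟨TauPairing.exists_smooth_representative _, fun φ' β hφ' hβ => ?_⟩
  induction c using Quotient.inductionOn with
  | h α =>
  obtain ⟨h1, h2⟩ := hβ
  -- From here on only the free homotopy class matters.
  have hhom := (Quotient.exact (s := TauPairing.basedMapSetoid k _ 1) h2).homotopic.symm
  have hext : TauPairing.ExtendsToDisc (φ.symm ∘ φ') :=
    (TauPairing.gammaSetoid l).symm (Quotient.exact hφ')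
  refine TauPairing.nonempty_tauManifold_diffeo_sphere hext (fun y x => ?_) hhom
  change φ (TauPairing.rotate (Δ (α.1 y)) x) = TauPairing.rotate (Δ (α.1 y)) (φ x)
  rw [hΔ, hΔ, hφ]
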